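/- Let $n,m\in\mathbb N$. Let $\mathcal Q$ be the family of all cubes $Q\subset\mathbb R^n$ with sides parallel to the axes, $\ell_Q>0$ the side length and $|Q|=\ell_Q^n$ the volume of $Q$. Let $\vec P=(p_1,\dots,p_m)$ with $p_1,\dots,p_m\in(1,\infty)$ and $1/p=1/p_1+\cdots+1/p_m$. Assume that $$0<p\le p_0<\frac n\alpha,\qquad 0<\beta\le\alpha<mn,$$ and set $\theta=\frac{n-\beta p_0}{n-\alpha p_0}$, $q=\theta p$, $q_0=\theta p_0$. For a tuple $\vec f=(f_1,\dots,f_m)$ of locally integrable (real- or complex-valued) functions on $\mathbb R^n$ put $$\mathfrak I_\alpha(\vec f)(x)=\int_{(\mathbb R^n)^m}\frac{\prod_{i=1}^m f_i(y_i)}{(|x-y_1|+\cdots+|x-y_m|)^{mn-\alpha}}\,dy_1\cdots dy_m,$$ $$\|\vec f\|_{\mathcal M^{\vec P,p_0}}=\sup_{Q\in\mathcal Q}|Q|^{1/p_0}\prod_{i=1}^m\Big(\frac1{|Q|}\int_Q|f_i|^{p_i}\,dy\Big)^{1/p_i}$$ (with $0\cdot\infty=0$), and let $\mathcal M^{\vec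 P,p_0}$ be the set of all such $\vec f$ with finite norm. For a nonnegative Radon measure $\mu$ on $\mathbb R^n$, let $\mathcal M_\mu^{q,q_0}$ be the set of all $\mu$-measurable functions $g$ on $\mathbb R^n$ with $$\|g\|_{\mathcal M_\mu^{q,q_0}}=\sup_{Q\in\mathcal Q}|Q|^{1/q_0-1/q}\Big(\int_Q|g|^q\,d\mu\Big)^{1/q}<\infty.$$ Define $A_0\in[0,\infty]$ as follows. (a) If $p\in(0,1]$, $$A_0=\sup_{Q\in\mathcal Q}\ell_Q^\beta\Big(\frac{\mu(Q)}{|Q|}\Big)^{1/p}.$$ (b) If $p\in(1,\infty)$, $$A_0=\sup_{Q\in\mathcal Q}\Big(\frac1{\mu(Q)}\int_Q\big(M_\beta[\mu\mathbf 1_Q](x)\big)^{p'}dx\Big)^{1/p'},\qquad M_\beta[\mu\mathbf 1_Q](x)=\sup_{x\in R\in\mathcal Q}\ell_R^{\beta-n}\mu(R\cap Q),$$ where $p'=p/(p-1)$ and cubes with $\mu(Q)=0$ contribute $0$. **Theorem.** There is a constant $C<\infty$, depending only on $n,m,\vec P,p_0,\alpha,\beta$, such that for every nonnegative Radon measure $\mu$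 on $\mathbb R^n$ with $A_0<\infty$ and every $\vec f\in\mathcal M^{\vec P,p_0}$, the integral defining $\mathfrak I_\alpha(\vec f)(x)$ converges absolutely for $\mu$-almost every $x$, the function $\mathfrak I_\alpha(\vec f)$ belongs to $\mathcal M_\mu^{q,q_0}$, and $$\|\mathfrak I_\alpha(\vec f)\|_{\mathcal M_\mu^{q,q_0}}\le C\,A_0^{1/\theta}\,\|\vec f\|_{\mathcal M^{\vec P,p_0}}.$$ -/

import Mathlib

open MeasureTheory
open scoped ENNReal NNReal

namespace ProductMorrey

/-- The Euclidean space `ℝⁿ`, with the Euclidean norm and Lebesgue measure. -/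
abbrev E (n : ℕ) : Type := EuclideanSpace ℝ (Fin n)

/-- A cube in `ℝⁿ` with sides parallel to the axes, given by its lower corner and its
positive side length. -/
structure Cube (n : ℕ) where
  corner : E n
  side : ℝ
  side_pos : 0 < side

/-- The points of a cube. Cubes are half-open, as dyadic cubes are; none of the suprema over
cubes below changes if closed or open cubes are used instead. -/
def Cube.toSet {n : ℕ} (Q : Cube n) : Set (E n) :=
  {x | ∀ i, Q.corner i ≤ x i ∧ x i < Q.corner i + Q.side}

/-- The integrand, as a function of `y = (y₁, …, yₘ)`, of the `m`-linear fractional integral: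
`∏ᵢ fᵢ(yᵢ) / (|x - y₁| + ⋯ + |x - yₘ|) ^ (mn - α)`. -/
noncomputable def fracIntegrand {n m : ℕ} (α : ℝ) (f : Fin m → E n → ℂ) (x : E n)
    (y : Fin m → E n) : ℂ :=
  (∏ i, f i (y i)) / (((∑ i, ‖x - y i‖) ^ ((m : ℝ) * (n : ℝ) - α) : ℝ) : ℂ)

/-- The `m`-linear fractional integral operator of order `α`. -/
noncomputable def fracIntegral {n m : ℕ} (α : ℝ) (f : Fin m → E n → ℂ) (x : E n) : ℂ :=
  ∫ y : Fin m → E n, fracIntegrand α f x y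

/-- The product Morrey norm
`sup_Q |Q|^(1/p₀) ∏ᵢ (|Q|⁻¹ ∫_Q |fᵢ|^(pᵢ) dy)^(1/pᵢ)`, with values in `[0, ∞]`. -/
noncomputable def prodMorreyNorm {n m : ℕ} (P : Fin m → ℝ) (p₀ : ℝ)
    (f : Fin m → E n → ℂ) : ℝ≥0∞ :=
  ⨆ Q : Cube n, volume Q.toSet ^ (1 / p₀) *
    ∏ i, (⨍⁻ y in Q.toSet, ‖f i y‖ₑ ^ (P i) ∂volume) ^ (1 / P i)

/-- The product Morrey space: tuples of locally integrable functions with finite norm. -/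
def MemProdMorrey {n m : ℕ} (P : Fin m → ℝ) (p₀ : ℝ) (f : Fin m → E n → ℂ) : Prop :=
  (∀ i, LocallyIntegrable (f i) volume) ∧ prodMorreyNorm P p₀ f < ⊤

/-- The Radon-Morrey norm `sup_Q |Q|^(1/q₀ - 1/q) (∫_Q |g|^q dμ)^(1/q)`, with values in
`[0, ∞]`. -/
noncomputable def radonMorreyNorm {n : ℕ} (μ : Measure (E n)) (q q₀ : ℝ)
    (g : E n → ℂ) : ℝ≥0∞ :=
  ⨆ Q : Cube n, volume Q.toSet ^ (1 / q₀ - 1 / q) *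
    (∫⁻ x in Q.toSet, ‖g x‖ₑ ^ q ∂μ) ^ (1 / q)

/-- The Radon-Morrey space: `μ`-measurable functions with finite norm. -/
def MemRadonMorrey {n : ℕ} (μ : Measure (E n)) (q q₀ : ℝ) (g : E n → ℂ) : Prop :=
  AEStronglyMeasurable g μ ∧ radonMorreyNorm μ q q₀ g < ⊤

/-- The fractional maximal function of a measure,
`M_β[ν](x) = sup_{x ∈ Q} ℓ_Q^(β - n) ν(Q)`. -/
noncomputable def fracMaximal {n : ℕ} (β : ℝ) (ν : Measure (E n)) (x : E n) : ℝ≥0∞ :=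
  ⨆ (Q : Cube n) (_ : x ∈ Q.toSet), ENNReal.ofReal Q.side ^ (β - (n : ℝ)) * ν Q.toSet

/-- The constant `sup_Q ℓ_Q^β (μ(Q) / |Q|)^(1/p)`. -/
noncomputable def densityConst {n : ℕ} (β p : ℝ) (μ : Measure (E n)) : ℝ≥0∞ :=
  ⨆ Q : Cube n, ENNReal.ofReal Q.side ^ β * (μ Q.toSet / volume Q.toSet) ^ (1 / p)

/-- The Kerman-Sawyer constant `sup_Q (μ(Q)⁻¹ ∫_Q M_β[μ 1_Q]^(p') dx)^(1/p')` with
`p' = p / (p - 1)`. A cube with `μ(Q) = 0` contributes `0` (the integral vanishes too). -/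
noncomputable def kermanSawyerConst {n : ℕ} (β p : ℝ) (μ : Measure (E n)) : ℝ≥0∞ :=
  ⨆ Q : Cube n,
    ((∫⁻ x in Q.toSet, fracMaximal β (μ.restrict Q.toSet) x ^ (p / (p - 1)) ∂volume) /
      μ Q.toSet) ^ (1 / (p / (p - 1)))

end ProductMorrey

/-!
The proof runs entirely on dyadic models, and splits a sum over the cubes of a grid by scale.

By the one-third trick, every ball lies in a cube of comparable size of one of `2 ^ n` shifted
dyadic grids (`exists_gridIdx_eq_of_norm_sub_le`). Hence the integral of the absolute value of the
integrand is at most a constant times a finite sum of dyadic fractional integrals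
`∑ ℓ(Q) ^ α ∏ₗ ⨍_Q |f l|`, over the cubes `Q ∋ x` of a grid (`lintegral_enorm_fracIntegrand_le`).
By Hölder's inequality the product of averages over `Q` is at most `|Q| ^ (-1/p₀) ‖f‖`. Comparing
this with the sum of order `β` at a well chosen scale bounds the sum of order `α` by the power
`1/θ` of the sum of order `β` times `‖f‖ ^ (1 - 1/θ)` (`exists_tsum_le_rpow_mul_rpow`), so that
only the order `β`, with `q = p`, is left.

Fix a cube `Q`. On `Q`, the scales above `ℓ(Q)` contribute a geometric series that the Morrey norm
and the density condition `μ(Q) ≤ A₀ ^ p ℓ(Q) ^ (n - βp)` control; for `p > 1` the density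
condition follows from the testing condition (`densityConst_le_kermanSawyerConst`). The scales up
to `ℓ(Q)` see only the restriction of `f` to the triple of `Q`, and for them the global trace
inequality `exists_lintegral_dyadicFracIntegral_rpow_le`, from `∏ L ^ P l` to `L ^ p(μ)`, is used.

The trace inequality is proved for finite laminar families of sets, in the form
`∫ (∑ w i a i 1_{Q i}) ^ p dμ ≤ C A₀ ^ p ∫ (sup a i 1_{Q i}) ^ p dx` with `w i = ℓ(Q i) ^ β` and
`a i` the product of averages; the right side is then bounded by the inequalities of Hölder and
Doob. For `p ≤ 1`, cut `a` at the levels `2 ^ k`: the weights of the cubes above a level that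
contain a given point form a geometric series, dominated by the largest such cube, and the maximal
cubes of a level are disjoint, so the density condition applies to each of them. For `p > 1`, pair
the sum with a function `g`. The Carleson embedding theorem
`Laminar.sum_mul_le_lintegral_finMax`, for Lebesgue measure weighted by the fractional maximal
function of `g dμ`, bounds the pairing by the integral of the product of that maximal function
and `sup a i 1_{Q i}`. The former is bounded from `L ^ p'(μ)` to `L ^ p'(dx)` by
Sawyer's argument, which needs the testing condition only (`Laminar.lintegral_finMax_le_of_testing`).
-/

namespace ProductMorrey

/-! ### Finite laminar families: Doob and Carleson inequalities -/

section Laminar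

variable {ι X : Type*}

/-- A family of sets is laminar if any two of its members are nested or disjoint, as dyadic
cubes are. -/
def Laminar (Q : ι → Set X) : Prop :=
  ∀ i j, Q i ⊆ Q j ∨ Q j ⊆ Q i ∨ Disjoint (Q i) (Q j)

/-- The maximal function `x ↦ max {a i | i ∈ s, x ∈ Q i}` of a finite family of sets with
weights `a`. -/
noncomputable def finMax (s : Finset ι) (Q : ι → Set X) (a : ι → ℝ≥0∞) (x : X) : ℝ≥0∞ :=
  s.sup fun i => (Q i).indicator (fun _ => a i) x

variable {Q : ι → Set X} {s : Finset ι} {a : ι → ℝ≥0∞}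

theorem lt_finMax_iff {t : ℝ≥0∞} {x : X} :
    t < finMax s Q a x ↔ ∃ i ∈ s, x ∈ Q i ∧ t < a i := by
  unfold finMax
  rw [Finset.lt_sup_iff]
  refine exists_congr fun i => and_congr_right fun _ => ?_
  by_cases h : x ∈ Q i <;> simp [h]

theorem le_finMax {i : ι} (hi : i ∈ s) {x : X} (hx : x ∈ Q i) : a i ≤ finMax s Q a x := by
  refine le_trans (le_of_eq ?_)
    (Finset.le_sup (f := fun i => (Q i).indicator (fun _ => a i) x) hi)
  simp [hx]

theorem finMax_le {x : X} {B : ℝ≥0∞} (h : ∀ i ∈ s, x ∈ Q i → a i ≤ B) :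
    finMax s Q a x ≤ B := by
  refine Finset.sup_le fun i hi => ?_
  by_cases hx : x ∈ Q i
  · simpa [hx] using h i hi hx
  · simp [hx]

theorem finMax_rpow {r : ℝ} (hr : 0 < r) (x : X) :
    finMax s Q a x ^ r = finMax s Q (fun i => a i ^ r) x := by
  apply le_antisymm
  · rw [← ENNReal.le_rpow_inv_iff hr]
    refine finMax_le fun i hi hx => ?_
    rw [ENNReal.le_rpow_inv_iff hr]
    exact le_finMax (a := fun i => a i ^ r) hi hx
  · exact finMax_le fun i hi hx => ENNReal.rpow_le_rpow (le_finMax hi hx) hr.le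

theorem measurable_finMax [MeasurableSpace X] (hm : ∀ i, MeasurableSet (Q i)) :
    Measurable (finMax s Q a) := by
  unfold finMax
  simp only [Finset.sup_eq_iSup]
  exact Measurable.biSup _ s.countable_toSet fun i _ => measurable_const.indicator (hm i)

theorem finMax_ne_top (ha : ∀ i ∈ s, a i ≠ ⊤) (x : X) : finMax s Q a x ≠ ⊤ := by
  refine ne_of_lt (lt_of_le_of_lt (finMax_le (B := ∑ i ∈ s, a i) fun i hi _ => ?_) ?_)
  · exact Finset.single_le_sum (f := a) (fun _ _ => zero_le) hi
  · exact ENNReal.sum_lt_top.2 fun i hi => (ha i hi).lt_top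

open Classical in
theorem setOf_lt_finMax (t : ℝ≥0∞) :
    {x | t < finMax s Q a x} = ⋃ i ∈ s.filter (fun i => t < a i), Q i := by
  ext x
  simp only [Set.mem_ofPred_eq, lt_finMax_iff, Set.mem_iUnion, Finset.mem_filter, exists_prop]
  exact exists_congr fun i => by tauto

/-- Every finite subfamily of a laminar family is covered by disjoint members of it. -/
theorem Laminar.exists_disjoint_cover (hQ : Laminar Q) (u : Finset ι) :
    ∃ v ⊆ u, (v : Set ι).PairwiseDisjoint Q ∧ ∀ i ∈ u, ∃ j ∈ v, Q i ⊆ Q j := by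
  classical
  induction u using Finset.induction_on with
  | empty => exact ⟨∅, by simp⟩
  | insert i u hi ih =>
    obtain ⟨v, hvu, hv, hc⟩ := ih
    by_cases h : ∃ j ∈ v, Q i ⊆ Q j
    · refine ⟨v, hvu.trans (Finset.subset_insert _ _), hv, fun k hk => ?_⟩
      rcases Finset.mem_insert.1 hk with rfl | hk
      exacts [h, hc k hk]
    · push Not at h
      refine ⟨insert i (v.filter fun j => ¬ Q j ⊆ Q i), ?_, ?_, ?_⟩
      · exact Finset.insert_subset_insert _ ((Finset.filter_subset _ _).trans hvu)
      · rw [Finset.coe_insert, Set.pairwiseDisjoint_insert]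
        refine ⟨hv.subset fun j hj => (Finset.mem_filter.1 hj).1, fun j hj _ => ?_⟩
        replace hj := Finset.mem_filter.1 hj
        rcases hQ i j with h1 | h1 | h1
        exacts [absurd h1 (h j hj.1), absurd h1 hj.2, h1]
      · intro k hk
        rcases Finset.mem_insert.1 hk with rfl | hk
        · exact ⟨k, Finset.mem_insert_self _ _, subset_rfl⟩
        · obtain ⟨j, hj, hkj⟩ := hc k hk
          by_cases hji : Q j ⊆ Q i
          · exact ⟨i, Finset.mem_insert_self _ _, hkj.trans hji⟩
          · exact ⟨j, Finset.mem_insert_of_mem (Finset.mem_filter.2 ⟨hj, hji⟩), hkj⟩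

theorem finMax_le_sum (x : X) : finMax s Q a x ≤ ∑ i ∈ s, (Q i).indicator (fun _ => a i) x := by
  refine finMax_le fun i hi hx => ?_
  refine le_trans (le_of_eq ?_) (Finset.single_le_sum
    (f := fun i => (Q i).indicator (fun _ => a i) x) (fun _ _ => zero_le) hi)
  simp [hx]

variable [MeasurableSpace X]

/-- If `c μ ≤ ν` on each set of a finite laminar family, then also on its union. -/
theorem Laminar.mul_measure_biUnion_le (hQ : Laminar Q) (hm : ∀ i, MeasurableSet (Q i))
    {μ ν : Measure X} {c : ℝ≥0∞} (u : Finset ι) (h : ∀ i ∈ u, c * μ (Q i) ≤ ν (Q i)) :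
    c * μ (⋃ i ∈ u, Q i) ≤ ν (⋃ i ∈ u, Q i) := by
  obtain ⟨v, hvu, hv, hc⟩ := hQ.exists_disjoint_cover u
  have hU : (⋃ i ∈ u, Q i) = ⋃ i ∈ v, Q i := by
    apply subset_antisymm
    · refine Set.iUnion₂_subset fun i hi => ?_
      obtain ⟨j, hj, hij⟩ := hc i hi
      exact hij.trans (Set.subset_biUnion_of_mem (u := Q) (Finset.mem_coe.2 hj))
    · exact Set.biUnion_subset_biUnion_left hvu
  rw [hU, measure_biUnion_finset hv fun i _ => hm i, measure_biUnion_finset hv fun i _ => hm i,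
    Finset.mul_sum]
  exact Finset.sum_le_sum fun i hi => h i (hvu hi)

open Classical in
/-- Coefficients dominated by `ω` inside each set of a laminar family are also dominated by `ω` on
the union of any subfamily, by covering it with disjoint members. -/
theorem Laminar.sum_le_measure_biUnion (hQ : Laminar Q) (hm : ∀ i, MeasurableSet (Q i))
    {ω : Measure X} {b : ι → ℝ≥0∞} {s u : Finset ι} (hus : u ⊆ s)
    (h : ∀ j ∈ s, ∑ i ∈ s with Q i ⊆ Q j, b i ≤ ω (Q j)) :
    ∑ i ∈ u, b i ≤ ω (⋃ i ∈ u, Q i) := by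
  obtain ⟨v, hvu, hv, hc⟩ := hQ.exists_disjoint_cover u
  calc ∑ i ∈ u, b i ≤ ∑ i ∈ u, ∑ j ∈ v, if Q i ⊆ Q j then b i else 0 := by
        refine Finset.sum_le_sum fun i hi => ?_
        obtain ⟨j, hj, hij⟩ := hc i hi
        refine le_trans (le_of_eq ?_) (Finset.single_le_sum
          (f := fun j => if Q i ⊆ Q j then b i else 0) (fun _ _ => zero_le) hj)
        simp [hij]
    _ = ∑ j ∈ v, ∑ i ∈ u, if Q i ⊆ Q j then b i else 0 := Finset.sum_comm
    _ ≤ ∑ j ∈ v, ω (Q j) := by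
        refine Finset.sum_le_sum fun j hj => le_trans ?_ (h j (hus (hvu hj)))
        rw [← Finset.sum_filter]
        exact Finset.sum_le_sum_of_subset (Finset.filter_subset_filter _ hus)
    _ = ω (⋃ i ∈ v, Q i) := (measure_biUnion_finset hv fun i _ => hm i).symm
    _ ≤ _ := measure_mono (Set.biUnion_subset_biUnion_left hvu)

/-- The layer-cake formula for powers of a finite function with values in `[0, ∞]`. -/
theorem lintegral_rpow_eq_lintegral_meas_ofReal_lt {μ : Measure X} {g : X → ℝ≥0∞}
    (hg : Measurable g) (hfin : ∀ x, g x ≠ ⊤) {p : ℝ} (hp : 0 < p) :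
    ∫⁻ x, g x ^ p ∂μ = ENNReal.ofReal p *
      ∫⁻ t in Set.Ioi (0 : ℝ), μ {x | ENNReal.ofReal t < g x} * ENNReal.ofReal (t ^ (p - 1)) := by
  have h := lintegral_rpow_eq_lintegral_meas_lt_mul μ (f := fun x => (g x).toReal)
    (Filter.Eventually.of_forall fun x => ENNReal.toReal_nonneg) hg.ennreal_toReal.aemeasurable hp
  have h1 : ∀ x, ENNReal.ofReal ((g x).toReal ^ p) = g x ^ p := fun x => by
    rw [← ENNReal.ofReal_rpow_of_nonneg ENNReal.toReal_nonneg hp.le,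
      ENNReal.ofReal_toReal (hfin x)]
  simp only [h1] at h
  rw [h]
  congr 1
  refine setLIntegral_congr_fun measurableSet_Ioi fun t ht => ?_
  have : ∀ x, ENNReal.ofReal t < g x ↔ t < (g x).toReal := fun x =>
    ENNReal.ofReal_lt_iff_lt_toReal (le_of_lt ht) (hfin x)
  simp only [this]

/-- A finite quantity bounded by `K` times a power `1/q < 1` of itself can be absorbed. -/
theorem le_rpow_of_le_mul_rpow {I K : ℝ≥0∞} (hI : I ≠ ⊤) {p q : ℝ} (hpq : p.HolderConjugate q)
    (h : I ≤ K * I ^ (1 / q)) : I ≤ K ^ p := by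
  rcases eq_or_ne I 0 with rfl | h0
  · exact zero_le
  have hq : I ^ (1 / q) ≠ 0 := by
    simp [ENNReal.rpow_eq_zero_iff, h0, hI]
  have hq' : I ^ (1 / q) ≠ ⊤ := ENNReal.rpow_ne_top_of_nonneg (by
    have := hpq.symm.pos; positivity) hI
  have h1 : I ^ (1 / p) ≤ K := by
    rw [← ENNReal.mul_le_mul_iff_left hq hq', ← ENNReal.rpow_add _ _ h0 hI]
    have := hpq.inv_add_inv_eq_one
    simp only [one_div] at *
    rwa [this, ENNReal.rpow_one]
  rw [one_div] at h1
  rwa [← ENNReal.rpow_inv_le_iff hpq.pos]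

/-- A finite combination of indicators of sets of finite measure has finite power integrals. -/
theorem lintegral_rpow_ne_top_of_le {μ : Measure X} (hm : ∀ i, MeasurableSet (Q i))
    (ha : ∀ i ∈ s, a i ≠ ⊤) (hμ : ∀ i ∈ s, μ (Q i) ≠ ⊤) {g : X → ℝ≥0∞}
    (hg : ∀ x, g x ≤ ∑ i ∈ s, (Q i).indicator (fun _ => a i) x) {p : ℝ} (hp : 0 < p) :
    ∫⁻ x, g x ^ p ∂μ ≠ ⊤ := by
  set B := ∑ i ∈ s, a i
  have hB : B ≠ ⊤ := ENNReal.sum_ne_top.2 ha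
  have hU : μ (⋃ i ∈ s, Q i) ≠ ⊤ :=
    ((measure_biUnion_finset_le s Q).trans_lt (ENNReal.sum_lt_top.2 fun i hi =>
      (hμ i hi).lt_top)).ne
  refine ((lintegral_mono fun x => ?_).trans_lt (b := ∫⁻ x, (⋃ i ∈ s, Q i).indicator
    (fun _ => B ^ p) x ∂μ) ?_).ne
  · by_cases hx : x ∈ ⋃ i ∈ s, Q i
    · rw [Set.indicator_of_mem hx]
      refine ENNReal.rpow_le_rpow ((hg x).trans (Finset.sum_le_sum fun i _ => ?_)) hp.le
      exact Set.indicator_le_self' (fun _ _ => zero_le) x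
    · have : g x = 0 := by
        refine le_antisymm ((hg x).trans (le_of_eq (Finset.sum_eq_zero fun i hi => ?_))) zero_le
        refine Set.indicator_of_notMem (fun h => hx ?_) _
        exact Set.mem_biUnion (Finset.mem_coe.2 hi) h
      simp [this, hp]
  · rw [lintegral_indicator (Finset.measurableSet_biUnion s fun i _ => hm i), setLIntegral_const]
    exact ENNReal.mul_lt_top (ENNReal.rpow_lt_top_of_nonneg hp.le hB) hU.lt_top

/-- Doob's maximal inequality for averages over a finite laminar family. -/
theorem Laminar.lintegral_finMax_rpow_le (hQ : Laminar Q) (hm : ∀ i, MeasurableSet (Q i))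
    {μ : Measure X} (hμ : ∀ i ∈ s, μ (Q i) ≠ ⊤) (ha : ∀ i ∈ s, a i ≠ ⊤) {f : X → ℝ≥0∞}
    (hf : AEMeasurable f μ) (h : ∀ i ∈ s, a i * μ (Q i) ≤ ∫⁻ x in Q i, f x ∂μ)
    {p : ℝ} (hp : 1 < p) :
    ∫⁻ x, finMax s Q a x ^ p ∂μ ≤
      ENNReal.ofReal (p / (p - 1)) ^ p * ∫⁻ x, f x ^ p ∂μ := by
  classical
  set M := finMax s Q a
  have hM : Measurable M := measurable_finMax hm
  have hMt : ∀ x, M x ≠ ⊤ := finMax_ne_top ha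
  set ν := μ.withDensity f
  have hp0 : 0 < p := by linarith
  have hp1 : 0 < p - 1 := by linarith
  have hlevel : ∀ t : ℝ, ENNReal.ofReal t * μ {x | ENNReal.ofReal t < M x} ≤
      ν {x | ENNReal.ofReal t < M x} := fun t => by
    rw [setOf_lt_finMax]
    refine hQ.mul_measure_biUnion_le hm _ fun i hi => ?_
    rw [Finset.mem_filter] at hi
    rw [withDensity_apply _ (hm i)]
    exact (mul_le_mul_left hi.2.le _).trans (h i hi.1)
  have hpq : p.HolderConjugate (p / (p - 1)) := Real.HolderConjugate.conjExponent hp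
  -- by the level inequality, compare the layer-cake formulas of `M ^ p` under `μ` and of
  -- `M ^ (p - 1)` under `f μ`
  have h1 : ∫⁻ x, M x ^ p ∂μ ≤ ENNReal.ofReal (p / (p - 1)) * ∫⁻ x, M x ^ (p - 1) ∂ν := by
    rw [lintegral_rpow_eq_lintegral_meas_ofReal_lt hM hMt hp0,
      lintegral_rpow_eq_lintegral_meas_ofReal_lt hM hMt hp1, ← mul_assoc,
      ← ENNReal.ofReal_mul (by positivity), div_mul_cancel₀ _ hp1.ne']
    refine mul_le_mul_right ?_ _
    refine setLIntegral_mono' measurableSet_Ioi fun t ht => ?_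
    have ht : 0 < t := ht
    have : ENNReal.ofReal (t ^ (p - 1)) = ENNReal.ofReal t * ENNReal.ofReal (t ^ (p - 1 - 1)) := by
      rw [← ENNReal.ofReal_mul ht.le]
      congr 1
      rw [Real.rpow_sub_one ht.ne' (p - 1)]
      field_simp
    rw [this, ← mul_assoc, mul_comm (μ _)]
    exact mul_le_mul_left (hlevel t) _
  have h2 : ∫⁻ x, M x ^ (p - 1) ∂ν ≤
      (∫⁻ x, f x ^ p ∂μ) ^ (1 / p) * (∫⁻ x, M x ^ p ∂μ) ^ (1 / (p / (p - 1))) := by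
    rw [lintegral_withDensity_eq_lintegral_mul₀ hf (hM.pow_const _).aemeasurable]
    refine (ENNReal.lintegral_mul_le_Lp_mul_Lq μ hpq hf
      (hM.pow_const (p - 1)).aemeasurable).trans (le_of_eq ?_)
    congr 3 with x
    rw [← ENNReal.rpow_mul]
    congr 1
    field_simp
  have h3 := le_rpow_of_le_mul_rpow (lintegral_rpow_ne_top_of_le hm ha hμ finMax_le_sum hp0) hpq
    ((h1.trans (mul_le_mul_right h2 _)).trans (le_of_eq (mul_assoc _ _ _).symm))
  refine h3.trans (le_of_eq ?_)
  rw [ENNReal.mul_rpow_of_nonneg _ _ hp0.le, ← ENNReal.rpow_mul, one_div,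
    inv_mul_cancel₀ hp0.ne', ENNReal.rpow_one]

open Classical in
/-- A form of the Carleson embedding theorem: coefficients `b` that are dominated by `ω` inside
each set of a laminar family may be summed against any weights `a`. -/
theorem Laminar.sum_mul_le_lintegral_finMax (hQ : Laminar Q) (hm : ∀ i, MeasurableSet (Q i))
    {ω : Measure X} {b : ι → ℝ≥0∞} (ha : ∀ i ∈ s, a i ≠ ⊤)
    (h : ∀ j ∈ s, ∑ i ∈ s with Q i ⊆ Q j, b i ≤ ω (Q j)) :
    ∑ i ∈ s, b i * a i ≤ ∫⁻ x, finMax s Q a x ∂ω := by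
  have hM : Measurable (finMax s Q a) := measurable_finMax hm
  have h1 := lintegral_rpow_eq_lintegral_meas_ofReal_lt (μ := ω) hM (finMax_ne_top ha) one_pos
  simp only [ENNReal.rpow_one, sub_self, Real.rpow_zero, ENNReal.ofReal_one, mul_one,
    one_mul] at h1
  rw [h1]
  have h2 : ∀ i ∈ s, b i * a i =
      ∫⁻ t in Set.Ioi (0 : ℝ), (Set.Iio (a i).toReal).indicator (fun _ => b i) t := fun i hi => by
    rw [lintegral_indicator measurableSet_Iio, setLIntegral_const,
      Measure.restrict_apply measurableSet_Iio, Set.inter_comm, Set.Ioi_inter_Iio,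
      Real.volume_Ioo, sub_zero, ENNReal.ofReal_toReal (ha i hi)]
  rw [Finset.sum_congr rfl h2,
    ← lintegral_finsetSum _ fun i _ => measurable_const.indicator measurableSet_Iio]
  refine setLIntegral_mono' measurableSet_Ioi fun t ht => ?_
  rw [setOf_lt_finMax]
  refine le_trans (le_of_eq ?_) (hQ.sum_le_measure_biUnion hm (Finset.filter_subset _ s) h)
  rw [Finset.sum_filter]
  refine Finset.sum_congr rfl fun i hi => ?_
  rw [Set.indicator_apply]
  simp only [Set.mem_Iio, ENNReal.ofReal_lt_iff_lt_toReal (le_of_lt ht) (ha i hi)]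

end Laminar

/-! ### Geometric series over the dyadic scales, and powers of sums -/

section Geometric

theorem exists_tsum_ge_le {γ : ℝ} (hγ : 0 < γ) :
    ∃ C : ℝ≥0, ∀ k₀ : ℤ, ∑' k : ℤ, (if k₀ ≤ k then (2 : ℝ≥0∞) ^ (-γ * k) else 0) ≤
      C * 2 ^ (-γ * k₀) := by
  have hr : (2 : ℝ≥0∞) ^ (-γ) < 1 :=
    ENNReal.rpow_lt_one_of_one_lt_of_neg (by norm_num) (by linarith)
  have hC : (1 - (2 : ℝ≥0∞) ^ (-γ))⁻¹ ≠ ⊤ := by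
    rw [ENNReal.inv_ne_top]
    exact (tsub_pos_of_lt hr).ne'
  refine ⟨((1 - (2 : ℝ≥0∞) ^ (-γ))⁻¹).toNNReal, fun k₀ => le_of_eq ?_⟩
  rw [ENNReal.coe_toNNReal hC, ← (Equiv.addRight k₀).tsum_eq]
  have h2 : ∀ k : ℤ, (if k₀ ≤ Equiv.addRight k₀ k then
      (2 : ℝ≥0∞) ^ (-γ * ((Equiv.addRight k₀ k : ℤ) : ℝ)) else 0) =
      (if 0 ≤ k then (2 : ℝ≥0∞) ^ (-γ * k) else 0) * 2 ^ (-γ * k₀) := fun k => by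
    simp only [Equiv.coe_addRight, le_add_iff_nonneg_left, Int.cast_add, mul_add, ite_mul,
      zero_mul]
    rw [ENNReal.rpow_add _ _ (by norm_num) (by norm_num)]
  simp only [h2]
  rw [ENNReal.tsum_mul_right]
  congr 1
  rw [← (Nat.cast_injective (R := ℤ)).tsum_eq, ← ENNReal.tsum_geometric]
  · refine tsum_congr fun j => ?_
    simp only [Int.natCast_nonneg, if_true, Int.cast_natCast]
    rw [ENNReal.rpow_mul, ENNReal.rpow_natCast]
  · intro k hk
    rw [Function.mem_support, ne_eq, ite_eq_right_iff, Classical.not_imp] at hk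
    exact ⟨k.toNat, Int.toNat_of_nonneg hk.1⟩

theorem exists_tsum_le_le {γ : ℝ} (hγ : 0 < γ) :
    ∃ C : ℝ≥0, ∀ k₀ : ℤ, ∑' k : ℤ, (if k ≤ k₀ then (2 : ℝ≥0∞) ^ (γ * k) else 0) ≤
      C * 2 ^ (γ * k₀) := by
  obtain ⟨C, hC⟩ := exists_tsum_ge_le hγ
  refine ⟨C, fun k₀ => ?_⟩
  have h := hC (-k₀)
  rw [← (Equiv.neg ℤ).tsum_eq] at h
  simpa using h

theorem exists_two_rpow_lt_le {a : ℝ≥0∞} (h0 : a ≠ 0) (ht : a ≠ ⊤) :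
    ∃ k : ℤ, (2 : ℝ≥0∞) ^ (k : ℝ) < a ∧ a ≤ 2 * 2 ^ (k : ℝ) := by
  obtain ⟨k, hk⟩ := ENNReal.exists_mem_Ioc_zpow h0 ht (y := 2) (by norm_num) (by norm_num)
  refine ⟨k, ?_, ?_⟩
  · rw [ENNReal.rpow_intCast]; exact hk.1
  · rw [ENNReal.rpow_intCast]
    refine hk.2.trans (le_of_eq ?_)
    rw [ENNReal.zpow_add (by norm_num) (by norm_num), zpow_one, mul_comm]

/-- The powers of two below `a` form a geometric series; `a = 0` gives the empty sum. -/
theorem exists_tsum_two_rpow_lt_le {p : ℝ} (hp : 0 < p) :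
    ∃ C : ℝ≥0, ∀ a : ℝ≥0∞, a ≠ ⊤ →
      ∑' k : ℤ, (if (2 : ℝ≥0∞) ^ (k : ℝ) < a then (2 : ℝ≥0∞) ^ (p * k) else 0) ≤ C * a ^ p := by
  obtain ⟨C, hC⟩ := exists_tsum_le_le hp
  refine ⟨C, fun a ha => ?_⟩
  rcases eq_or_ne a 0 with rfl | h0
  · simp
  obtain ⟨k₀, h1, h2⟩ := exists_two_rpow_lt_le h0 ha
  have h3 : (2 : ℝ≥0∞) * 2 ^ (k₀ : ℝ) = 2 ^ ((k₀ + 1 : ℤ) : ℝ) := by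
    rw [Int.cast_add, Int.cast_one, ENNReal.rpow_add _ _ (by norm_num) (by norm_num),
      ENNReal.rpow_one, mul_comm]
  calc _ ≤ ∑' k : ℤ, (if k ≤ k₀ then (2 : ℝ≥0∞) ^ (p * k) else 0) := by
        refine ENNReal.tsum_le_tsum fun k => ?_
        split_ifs with h h' h'
        · exact le_rfl
        · exfalso
          refine absurd (h.trans_le (h2.trans_eq h3)) (not_lt.2 ?_)
          refine ENNReal.rpow_le_rpow_of_exponent_le (by norm_num) ?_
          exact_mod_cast (by omega : k₀ + 1 ≤ k)
        · exact zero_le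
        · exact le_rfl
    _ ≤ C * 2 ^ (p * k₀) := hC k₀
    _ ≤ C * a ^ p := by
        refine mul_le_mul_right ?_ _
        rw [mul_comm, ENNReal.rpow_mul]
        exact ENNReal.rpow_le_rpow h1.le hp.le

theorem le_two_mul_tsum_two_rpow_lt {a : ℝ≥0∞} (ha : a ≠ ⊤) :
    a ≤ 2 * ∑' k : ℤ, (if (2 : ℝ≥0∞) ^ (k : ℝ) < a then (2 : ℝ≥0∞) ^ (k : ℝ) else 0) := by
  rcases eq_or_ne a 0 with rfl | h0
  · simp
  obtain ⟨k₀, h1, h2⟩ := exists_two_rpow_lt_le h0 ha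
  refine h2.trans (mul_le_mul_right ?_ _)
  refine le_trans (le_of_eq ?_) (ENNReal.le_tsum k₀)
  rw [if_pos h1]

theorem sum_rpow_le_sum_rpow {κ : Type*} (s : Finset κ) (x : κ → ℝ≥0∞) {p : ℝ} (hp : 0 < p)
    (hp1 : p ≤ 1) : (∑ i ∈ s, x i) ^ p ≤ ∑ i ∈ s, x i ^ p := by
  classical
  induction s using Finset.induction_on with
  | empty => simp [hp]
  | insert i s hi ih =>
    rw [Finset.sum_insert hi, Finset.sum_insert hi]
    exact (ENNReal.rpow_add_le_add_rpow _ _ hp.le hp1).trans (by gcongr)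

theorem tsum_rpow_le_tsum_rpow {κ : Type*} (x : κ → ℝ≥0∞) {p : ℝ} (hp : 0 < p) (hp1 : p ≤ 1) :
    (∑' i, x i) ^ p ≤ ∑' i, x i ^ p := by
  rw [← ENNReal.le_rpow_inv_iff hp, ENNReal.tsum_eq_iSup_sum]
  refine iSup_le fun s => ?_
  rw [ENNReal.le_rpow_inv_iff hp]
  exact (sum_rpow_le_sum_rpow s x hp hp1).trans (ENNReal.sum_le_tsum s)

/-- A quasi-triangle inequality for powers of finite sums, for exponents below and above `1`. -/
theorem sum_rpow_le_card_rpow_mul {κ : Type*} (s : Finset κ) (x : κ → ℝ≥0∞) {p : ℝ}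
    (hp : 0 < p) : (∑ i ∈ s, x i) ^ p ≤ (s.card : ℝ≥0∞) ^ p * ∑ i ∈ s, x i ^ p := by
  rw [← ENNReal.le_rpow_inv_iff hp, ENNReal.mul_rpow_of_nonneg _ _ (by positivity),
    ← ENNReal.rpow_mul, mul_inv_cancel₀ hp.ne', ENNReal.rpow_one, ← nsmul_eq_mul]
  refine Finset.sum_le_card_nsmul _ _ _ fun i hi => ?_
  rw [ENNReal.le_rpow_inv_iff hp]
  exact Finset.single_le_sum (f := fun i => x i ^ p) (fun _ _ => zero_le) hi

end Geometric

/-! ### Trace inequalities for finite laminar families -/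

section Testing

variable {ι X : Type*} {Q : ι → Set X} {s : Finset ι} {a : ι → ℝ≥0∞}

theorem sum_indicator_le_of_pairwiseDisjoint {E : ι → Set X} {u : Finset ι}
    (hd : (u : Set ι).PairwiseDisjoint E) {x : X} {B : ℝ≥0∞} (h : ∀ i ∈ u, x ∈ E i → a i ≤ B) :
    ∑ i ∈ u, (E i).indicator (fun _ => a i) x ≤ B := by
  classical
  by_cases hx : ∃ i ∈ u, x ∈ E i
  · obtain ⟨i, hi, hxi⟩ := hx
    rw [Finset.sum_eq_single_of_mem i hi, Set.indicator_of_mem hxi]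
    · exact h i hi hxi
    · intro j hj hji
      exact Set.indicator_of_notMem (fun hxj => Set.disjoint_left.1 (hd hj hi hji) hxj hxi) _
  · push Not at hx
    rw [Finset.sum_eq_zero fun i hi => Set.indicator_of_notMem (hx i hi) _]
    exact zero_le

variable [MeasurableSpace X]

/-- A finite maximal function is linearized by disjoint measurable pieces `E i ⊆ Q i`, on which
the maximum is attained at `i`. -/
theorem exists_linearization (hm : ∀ i, MeasurableSet (Q i)) (s : Finset ι) (a : ι → ℝ≥0∞) :
    ∃ E : ι → Set X, (∀ i, MeasurableSet (E i)) ∧ (∀ i, E i ⊆ Q i) ∧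
      (s : Set ι).PairwiseDisjoint E ∧
      ∀ x, finMax s Q a x ≤ ∑ i ∈ s, (E i).indicator (fun _ => a i) x := by
  classical
  induction s using Finset.induction_on with
  | empty => exact ⟨Q, hm, fun _ => subset_rfl, by simp, by simp [finMax]⟩
  | insert i s hi ih =>
    obtain ⟨E, hE, hEQ, hd, hle⟩ := ih
    set F : Set X := Q i ∩ {x | finMax s Q a x < a i}
    have hF : MeasurableSet F :=
      (hm i).inter (measurableSet_lt (measurable_finMax hm) measurable_const)
    have hne : ∀ {j}, j ∈ s → j ≠ i := fun hj h => hi (h ▸ hj)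
    refine ⟨fun j => if j = i then F else E j \ F, fun j => ?_, fun j => ?_, ?_, fun x => ?_⟩
    · dsimp only
      split_ifs
      exacts [hF, (hE j).diff hF]
    · dsimp only
      split_ifs with h
      · subst h; exact Set.inter_subset_left
      · exact Set.sdiff_subset.trans (hEQ j)
    · rw [Finset.coe_insert, Set.pairwiseDisjoint_insert]
      constructor
      · intro j hj k hk hjk
        simp only [Function.onFun, if_neg (hne hj), if_neg (hne hk)]
        exact (hd hj hk hjk).mono Set.sdiff_subset Set.sdiff_subset
      · intro j hj hij
        simp only [if_true, if_neg hij.symm]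
        exact Set.disjoint_sdiff_right
    · rw [Finset.sum_insert hi]
      simp only [if_true]
      have h1 : ∀ j ∈ s, (if j = i then F else E j \ F).indicator (fun _ => a j) x =
          (E j \ F).indicator (fun _ => a j) x := fun j hj => by rw [if_neg (hne hj)]
      rw [Finset.sum_congr rfl h1]
      by_cases hx : x ∈ F
      · refine le_add_right ?_
        rw [Set.indicator_of_mem hx]
        refine finMax_le fun j hj hxj => ?_
        rcases Finset.mem_insert.1 hj with rfl | hj
        · exact le_rfl
        · exact (le_finMax hj hxj).trans hx.2.le
      · have h2 : ∀ j ∈ s, (E j \ F).indicator (fun _ => a j) x =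
            (E j).indicator (fun _ => a j) x := fun j _ => by
          by_cases hj : x ∈ E j <;> simp [hj, hx]
        rw [Finset.sum_congr rfl h2, Set.indicator_of_notMem hx, zero_add]
        refine le_trans (finMax_le fun j hj hxj => ?_) (hle x)
        rcases Finset.mem_insert.1 hj with rfl | hj
        · exact not_lt.1 fun h => hx ⟨hxj, h⟩
        · exact le_finMax hj hxj

/-- Sawyer's testing theorem for a maximal operator `g ↦ sup κ i ∫_{Q i} g dμ` over a finite
laminar family, as a bound from `L^r(μ)` to `L^r(σ)`: it is enough to test on `g = 1_{Q j}`. -/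
theorem Laminar.lintegral_finMax_le_of_testing (hQ : Laminar Q) (hm : ∀ i, MeasurableSet (Q i))
    {σ μ : Measure X} {κ : ι → ℝ≥0∞} {H : ι → X → ℝ≥0∞}
    (hH : ∀ i j, Q i ⊆ Q j → ∀ x ∈ Q i, κ i * μ (Q i) ≤ H j x) {r : ℝ} (hr : 1 < r) {K : ℝ≥0∞}
    (test : ∀ j, ∫⁻ x in Q j, H j x ^ r ∂σ ≤ K * μ (Q j)) (hμ : ∀ i, μ (Q i) ≠ ⊤)
    {g : X → ℝ≥0∞} (hg : AEMeasurable g μ) (hgt : ∀ i, ∫⁻ x in Q i, g x ∂μ ≠ ⊤) :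
    ∫⁻ x, finMax s Q (fun i => κ i * ∫⁻ x in Q i, g x ∂μ) x ^ r ∂σ ≤
      K * (ENNReal.ofReal (r / (r - 1)) ^ r * ∫⁻ x, g x ^ r ∂μ) := by
  classical
  have hr0 : 0 < r := by linarith
  set A : ι → ℝ≥0∞ := fun i => (∫⁻ x in Q i, g x ∂μ) / μ (Q i)
  set d : ι → ℝ≥0∞ := fun i => (κ i * μ (Q i)) ^ r
  have hA : ∀ i, A i * μ (Q i) = ∫⁻ x in Q i, g x ∂μ := fun i => by
    refine ENNReal.div_mul_cancel' (fun h => ?_) (fun h => absurd h (hμ i))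
    rw [Measure.restrict_eq_zero.2 h, lintegral_zero_measure]
  have hAt : ∀ i, A i ≠ ⊤ := fun i => by
    rcases eq_or_ne (μ (Q i)) 0 with h | h
    · have : ∫⁻ x in Q i, g x ∂μ = 0 := by
        rw [Measure.restrict_eq_zero.2 h, lintegral_zero_measure]
      simp [A, this]
    · exact ENNReal.div_ne_top (hgt i) h
  obtain ⟨E, hE, hEQ, hd, hle⟩ := exists_linearization hm s fun i => d i * A i ^ r
  have h1 : ∀ x, finMax s Q (fun i => κ i * ∫⁻ x in Q i, g x ∂μ) x ^ r =
      finMax s Q (fun i => d i * A i ^ r) x := fun x => by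
    rw [finMax_rpow hr0]
    congr 1
    ext i
    rw [← hA, ← ENNReal.mul_rpow_of_nonneg _ _ hr0.le]
    congr 1
    ring
  calc ∫⁻ x, finMax s Q (fun i => κ i * ∫⁻ x in Q i, g x ∂μ) x ^ r ∂σ
      ≤ ∫⁻ x, ∑ i ∈ s, (E i).indicator (fun _ => d i * A i ^ r) x ∂σ :=
        lintegral_mono fun x => (h1 x).trans_le (hle x)
    _ = ∑ i ∈ s, (d i * σ (E i)) * A i ^ r := by
        rw [lintegral_finsetSum _ fun i _ => measurable_const.indicator (hE i)]
        refine Finset.sum_congr rfl fun i _ => ?_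
        rw [lintegral_indicator_const (hE i)]
        ring
    _ ≤ ∫⁻ x, finMax s Q (fun i => A i ^ r) x ∂(K • μ) := by
        refine hQ.sum_mul_le_lintegral_finMax hm
          (fun i _ => ENNReal.rpow_ne_top_of_nonneg hr0.le (hAt i)) fun j _ => ?_
        rw [Measure.smul_apply, smul_eq_mul]
        refine le_trans ?_ (test j)
        have h2 : ∀ i ∈ s.filter (fun i => Q i ⊆ Q j), d i * σ (E i) =
            ∫⁻ x in Q j, (E i).indicator (fun _ => d i) x ∂σ := fun i hi => by
          rw [lintegral_indicator_const (hE i), Measure.restrict_apply (hE i),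
            Set.inter_eq_left.2 ((hEQ i).trans (Finset.mem_filter.1 hi).2)]
        rw [Finset.sum_congr rfl h2,
          ← lintegral_finsetSum _ fun i _ => measurable_const.indicator (hE i)]
        refine lintegral_mono fun x => sum_indicator_le_of_pairwiseDisjoint
          (hd.subset fun i hi => (Finset.mem_filter.1 hi).1) fun i hi hx => ?_
        exact ENNReal.rpow_le_rpow (hH i j (Finset.mem_filter.1 hi).2 x (hEQ i hx)) hr0.le
    _ = K * ∫⁻ x, finMax s Q A x ^ r ∂μ := by
        rw [lintegral_smul_measure, smul_eq_mul]
        simp only [finMax_rpow hr0]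
    _ ≤ _ := by
        refine mul_le_mul_right ?_ _
        exact hQ.lintegral_finMax_rpow_le hm (fun i _ => hμ i) (fun i _ => hAt i) hg
          (fun i _ => (hA i).le) hr

/-- The trace inequality for a finite laminar family when `1 < p`. Duality reduces it to the
pairing of `∑ w i a i 1_{Q i}` with a function `g`; by the Carleson embedding theorem this is at
most the pairing of two maximal functions, of which the one of `g dμ` is controlled by testing. -/
theorem Laminar.lintegral_sum_rpow_le_of_testing (hQ : Laminar Q)
    (hm : ∀ i, MeasurableSet (Q i)) {σ μ : Measure X} {w κ : ι → ℝ≥0∞} {H : ι → X → ℝ≥0∞}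
    {C K : ℝ≥0∞} (hw : ∀ i, w i = κ i * σ (Q i)) (hwt : ∀ i, w i ≠ ⊤)
    (hC : ∀ (u : Finset ι) (j : ι) (x : X), (∀ i ∈ u, x ∈ Q i ∧ Q i ⊆ Q j) →
      ∑ i ∈ u, w i ≤ C * w j)
    (hH : ∀ i j, Q i ⊆ Q j → ∀ x ∈ Q i, κ i * μ (Q i) ≤ H j x) {p q : ℝ}
    (hpq : p.HolderConjugate q)
    (test : ∀ j, ∫⁻ x in Q j, H j x ^ q ∂σ ≤ K ^ q * μ (Q j)) (hμ : ∀ i, μ (Q i) ≠ ⊤)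
    (ha : ∀ i, a i ≠ ⊤) :
    ∫⁻ x, (∑ i ∈ s, (Q i).indicator (fun _ => w i * a i) x) ^ p ∂μ ≤
      (C * ENNReal.ofReal p * K) ^ p * ∫⁻ x, finMax s Q a x ^ p ∂σ := by
  classical
  have hp0 := hpq.pos
  have hq0 := hpq.symm.pos
  have hp1 : 0 < p - 1 := hpq.sub_one_pos
  set Φ : X → ℝ≥0∞ := fun x => ∑ i ∈ s, (Q i).indicator (fun _ => w i * a i) x
  have hΦ : Measurable Φ :=
    Finset.measurable_fun_sum s fun i _ => measurable_const.indicator (hm i)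
  have hwa : ∀ i, w i * a i ≠ ⊤ := fun i => ENNReal.mul_ne_top (hwt i) (ha i)
  have hΦt : ∀ x, Φ x ≠ ⊤ := fun x => ENNReal.sum_ne_top.2 fun i _ =>
    ne_top_of_le_ne_top (hwa i) (Set.indicator_le_self' (fun _ _ => zero_le) x)
  -- the extremal function of the duality between `L ^ p` and `L ^ q`
  set g : X → ℝ≥0∞ := fun x => Φ x ^ (p - 1)
  have hg : Measurable g := hΦ.pow_const _
  have hgt : ∀ i, ∫⁻ x in Q i, g x ∂μ ≠ ⊤ := fun i => by
    refine lintegral_rpow_ne_top_of_le (s := s) hm (fun i _ => hwa i) (fun j _ => ?_)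
      (fun x => le_rfl) hp1
    exact ne_top_of_le_ne_top (hμ j) (Measure.restrict_apply_le _ _)
  set N : X → ℝ≥0∞ := finMax s Q fun i => κ i * ∫⁻ x in Q i, g x ∂μ
  have hN : Measurable N := measurable_finMax hm
  have hD : Measurable (finMax s Q a) := measurable_finMax hm
  have hmul : ∀ i (c : ℝ≥0∞), Measurable fun x => (Q i).indicator (fun _ => c) x * g x :=
    fun i c => (measurable_const.indicator (hm i)).mul hg
  have hqp : q / (q - 1) = p := hpq.symm.conjugate_eq.symm
  have hgq : ∀ x, g x ^ q = Φ x ^ p := fun x => by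
    simp only [g]
    rw [← ENNReal.rpow_mul, hpq.sub_one_mul_conj]
  have hΦg : ∀ x, Φ x ^ p = Φ x * g x := fun x => by
    simp only [g]
    rcases eq_or_ne (Φ x) 0 with h | h
    · simp [h, hp0]
    · nth_rw 2 [← ENNReal.rpow_one (Φ x)]
      rw [← ENNReal.rpow_add _ _ h (hΦt x)]
      congr 1
      ring
  have h1 : ∫⁻ x, Φ x ^ p ∂μ = ∑ i ∈ s, (w i * ∫⁻ x in Q i, g x ∂μ) * a i := by
    simp only [hΦg, Φ, Finset.sum_mul]
    rw [lintegral_finsetSum _ fun i _ => hmul i _]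
    refine Finset.sum_congr rfl fun i _ => ?_
    rw [← lintegral_indicator (hm i)]
    have : ∀ x, (Q i).indicator (fun _ => w i * a i) x * g x =
        w i * a i * (Q i).indicator g x := fun x => by
      by_cases hx : x ∈ Q i <;> simp [hx]
    simp only [this]
    rw [lintegral_const_mul _ (hg.indicator (hm i))]
    ring
  have h2 : ∑ i ∈ s, (w i * ∫⁻ x in Q i, g x ∂μ) * a i ≤
      ∫⁻ x, finMax s Q a x ∂(C • σ.withDensity N) := by
    refine hQ.sum_mul_le_lintegral_finMax hm (fun i _ => ha i) fun j hj => ?_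
    have h3 : ∀ i ∈ s.filter (fun i => Q i ⊆ Q j), w i * ∫⁻ x in Q i, g x ∂μ =
        ∫⁻ x in Q j, (Q i).indicator (fun _ => w i) x * g x ∂μ := fun i hi => by
      have : ∀ x, (Q i).indicator (fun _ => w i) x * g x =
          w i * (Q i).indicator g x := fun x => by
        by_cases hx : x ∈ Q i <;> simp [hx]
      simp only [this]
      rw [lintegral_const_mul _ (hg.indicator (hm i)), lintegral_indicator (hm i),
        Measure.restrict_restrict (hm i), Set.inter_eq_left.2 (Finset.mem_filter.1 hi).2]
    rw [Finset.sum_congr rfl h3,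
      ← lintegral_finsetSum _ fun i _ => hmul i _,
      Measure.smul_apply, smul_eq_mul, withDensity_apply _ (hm j)]
    calc ∫⁻ x in Q j, ∑ i ∈ s with Q i ⊆ Q j, (Q i).indicator (fun _ => w i) x * g x ∂μ
        ≤ ∫⁻ x in Q j, C * w j * g x ∂μ := by
          refine lintegral_mono fun x => ?_
          rw [← Finset.sum_mul]
          refine mul_le_mul_left ?_ _
          simp only [Set.indicator_apply]
          rw [← Finset.sum_filter]
          refine hC _ j x fun i hi => ?_
          simp only [Finset.mem_filter] at hi
          exact ⟨hi.2, hi.1.2⟩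
      _ = C * ∫⁻ x in Q j, κ j * ∫⁻ x in Q j, g x ∂μ ∂σ := by
          rw [lintegral_const_mul _ hg, setLIntegral_const, hw]
          ring
      _ ≤ C * ∫⁻ x in Q j, N x ∂σ := by
          refine mul_le_mul_right (setLIntegral_mono' (hm j) fun x hx => ?_) _
          exact le_finMax (a := fun i => κ i * ∫⁻ x in Q i, g x ∂μ) hj hx
  have h4 : ∫⁻ x, finMax s Q a x ∂(C • σ.withDensity N) ≤
      C * ((∫⁻ x, finMax s Q a x ^ p ∂σ) ^ (1 / p) * (∫⁻ x, N x ^ q ∂σ) ^ (1 / q)) := by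
    rw [lintegral_smul_measure, smul_eq_mul, lintegral_withDensity_eq_lintegral_mul _ hN hD,
      mul_comm N]
    exact mul_le_mul_right
      (ENNReal.lintegral_mul_le_Lp_mul_Lq σ hpq hD.aemeasurable hN.aemeasurable) _
  have h5 : (∫⁻ x, N x ^ q ∂σ) ^ (1 / q) ≤
      K * ENNReal.ofReal p * (∫⁻ x, Φ x ^ p ∂μ) ^ (1 / q) := by
    have h6 := hQ.lintegral_finMax_le_of_testing (s := s) hm hH hpq.symm.lt test hμ
      hg.aemeasurable hgt
    simp only [hgq, hqp] at h6
    refine (ENNReal.rpow_le_rpow h6 (by positivity)).trans (le_of_eq ?_)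
    rw [← mul_assoc, ← ENNReal.mul_rpow_of_nonneg _ _ hq0.le,
      ENNReal.mul_rpow_of_nonneg _ _ (by positivity : (0 : ℝ) ≤ 1 / q), ← ENNReal.rpow_mul,
      mul_one_div_cancel hq0.ne', ENNReal.rpow_one]
  have hfin : ∫⁻ x, Φ x ^ p ∂μ ≠ ⊤ :=
    lintegral_rpow_ne_top_of_le (s := s) hm (fun i _ => hwa i) (fun i _ => hμ i)
      (fun x => le_rfl) hp0
  have h7 : ∫⁻ x, Φ x ^ p ∂μ ≤ C * ENNReal.ofReal p * K *
      (∫⁻ x, finMax s Q a x ^ p ∂σ) ^ (1 / p) * (∫⁻ x, Φ x ^ p ∂μ) ^ (1 / q) := by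
    nth_rw 1 [h1]
    refine (h2.trans h4).trans ((mul_le_mul_right (mul_le_mul_right h5 _) _).trans
      (le_of_eq ?_))
    ring
  refine (le_rpow_of_le_mul_rpow hfin hpq h7).trans (le_of_eq ?_)
  rw [ENNReal.mul_rpow_of_nonneg _ _ hp0.le, ← ENNReal.rpow_mul, one_div,
    inv_mul_cancel₀ hp0.ne', ENNReal.rpow_one]

/-- The trace inequality for a finite laminar family when `p ≤ 1`. Splitting the weights `a` at
the levels `2 ^ k`, the sets above a level that contain a point contribute no more than the
largest of them does, and the largest ones are disjoint. -/
theorem Laminar.exists_lintegral_sum_rpow_le_of_density {p : ℝ} (hp : 0 < p) (hp1 : p ≤ 1) :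
    ∃ C' : ℝ≥0, ∀ {ι X : Type} [MeasurableSpace X] {Q : ι → Set X} (_ : Laminar Q)
      (_ : ∀ i, MeasurableSet (Q i)) {σ μ : Measure X} {w a : ι → ℝ≥0∞} {C K : ℝ≥0∞}
      (_ : ∀ (u : Finset ι) (j : ι) (x : X), (∀ i ∈ u, x ∈ Q i ∧ Q i ⊆ Q j) →
        ∑ i ∈ u, w i ≤ C * w j)
      (_ : ∀ i, w i ^ p * μ (Q i) ≤ K ^ p * σ (Q i)) (_ : ∀ i, a i ≠ ⊤) (s : Finset ι),
    ∫⁻ x, (∑ i ∈ s, (Q i).indicator (fun _ => w i * a i) x) ^ p ∂μ ≤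
      C' * (C * K) ^ p * ∫⁻ x, finMax s Q a x ^ p ∂σ := by
  classical
  obtain ⟨C₁, hC₁⟩ := exists_tsum_two_rpow_lt_le hp
  refine ⟨2 * C₁, ?_⟩
  intro ι X _ Q hQ hm σ μ w a C K hC hK ha s
  choose v hvu hv hc using fun k : ℤ =>
    hQ.exists_disjoint_cover (s.filter fun i => (2 : ℝ≥0∞) ^ (k : ℝ) < a i)
  have hpt : ∀ (k : ℤ) (x : X),
      (∑ i ∈ s, (Q i).indicator (fun _ => if (2 : ℝ≥0∞) ^ (k : ℝ) < a i then w i else 0) x) ^ p ≤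
        C ^ p * ∑ j ∈ v k, (Q j).indicator (fun _ => w j ^ p) x := fun k x => by
    simp only [Set.indicator_apply]
    rw [← Finset.sum_filter, ← Finset.sum_filter]
    by_cases hx : ∃ j ∈ v k, x ∈ Q j
    · obtain ⟨j, hj, hxj⟩ := hx
      have h1 : ∑ i ∈ (s.filter fun i => x ∈ Q i) with (2 : ℝ≥0∞) ^ (k : ℝ) < a i, w i ≤
          C * w j := by
        refine hC _ j x fun i hi => ?_
        simp only [Finset.mem_filter] at hi
        obtain ⟨j', hj', hij'⟩ := hc k i (Finset.mem_filter.2 ⟨hi.1.1, hi.2⟩)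
        have : j' = j := by
          by_contra hne
          exact Set.disjoint_left.1 (hv k hj' hj hne) (hij' hi.1.2) hxj
        exact ⟨hi.1.2, this ▸ hij'⟩
      refine (ENNReal.rpow_le_rpow h1 hp.le).trans ?_
      rw [ENNReal.mul_rpow_of_nonneg _ _ hp.le]
      refine mul_le_mul_right ?_ _
      refine le_trans (le_of_eq ?_) (Finset.single_le_sum
        (f := fun j => if x ∈ Q j then w j ^ p else 0) (fun _ _ => zero_le) hj)
      simp [hxj]
    · have h0 : ∑ i ∈ (s.filter fun i => x ∈ Q i) with (2 : ℝ≥0∞) ^ (k : ℝ) < a i, w i = 0 := by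
        rw [Finset.filter_eq_empty_iff.2, Finset.sum_empty]
        intro i hi hlt
        rw [Finset.mem_filter] at hi
        obtain ⟨j, hj, hij⟩ := hc k i (Finset.mem_filter.2 ⟨hi.1, hlt⟩)
        exact hx ⟨j, hj, hij hi.2⟩
      rw [h0, ENNReal.zero_rpow_of_pos hp]
      exact zero_le
  have hlevel : ∀ k : ℤ, ∫⁻ x, ∑ j ∈ v k, (Q j).indicator (fun _ => w j ^ p) x ∂μ ≤
      K ^ p * σ {x | (2 : ℝ≥0∞) ^ (k : ℝ) < finMax s Q a x} := fun k => by
    rw [lintegral_finsetSum _ fun i _ => measurable_const.indicator (hm i)]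
    simp only [lintegral_indicator_const (hm _)]
    refine (Finset.sum_le_sum fun j _ => hK j).trans ?_
    rw [← Finset.mul_sum, ← measure_biUnion_finset (hv k) fun i _ => hm i, setOf_lt_finMax]
    exact mul_le_mul_right (measure_mono (Set.biUnion_subset_biUnion_left (hvu k))) _
  have hsum : ∀ x, (∑ i ∈ s, (Q i).indicator (fun _ => w i * a i) x) ^ p ≤
      2 * ∑' k : ℤ, (2 : ℝ≥0∞) ^ (p * k) *
        (C ^ p * ∑ j ∈ v k, (Q j).indicator (fun _ => w j ^ p) x) := fun x => by
    have h1 : ∑ i ∈ s, (Q i).indicator (fun _ => w i * a i) x ≤ 2 * ∑' k : ℤ,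
        (2 : ℝ≥0∞) ^ (k : ℝ) * ∑ i ∈ s,
          (Q i).indicator (fun _ => if (2 : ℝ≥0∞) ^ (k : ℝ) < a i then w i else 0) x := by
      simp only [Finset.mul_sum]
      rw [Summable.tsum_finsetSum fun _ _ => ENNReal.summable, Finset.mul_sum]
      refine Finset.sum_le_sum fun i _ => ?_
      by_cases hx : x ∈ Q i
      · simp only [Set.indicator_of_mem hx, mul_ite, mul_zero]
        calc w i * a i ≤ w i * (2 * ∑' k : ℤ,
              (if (2 : ℝ≥0∞) ^ (k : ℝ) < a i then (2 : ℝ≥0∞) ^ (k : ℝ) else 0)) :=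
              mul_le_mul_right (le_two_mul_tsum_two_rpow_lt (ha i)) _
          _ = _ := by
              rw [mul_left_comm, ← ENNReal.tsum_mul_left]
              congr 2 with k
              split_ifs <;> ring
      · simp [hx]
    refine (ENNReal.rpow_le_rpow h1 hp.le).trans ?_
    rw [ENNReal.mul_rpow_of_nonneg _ _ hp.le]
    refine mul_le_mul' ?_ ((tsum_rpow_le_tsum_rpow _ hp hp1).trans ?_)
    · calc (2 : ℝ≥0∞) ^ p ≤ 2 ^ (1 : ℝ) :=
            ENNReal.rpow_le_rpow_of_exponent_le (by norm_num) hp1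
        _ = 2 := ENNReal.rpow_one _
    · refine ENNReal.tsum_le_tsum fun k => ?_
      rw [ENNReal.mul_rpow_of_nonneg _ _ hp.le, ← ENNReal.rpow_mul, mul_comm (k : ℝ) p]
      exact mul_le_mul_right (hpt k x) _
  have hmeas : ∀ k : ℤ, Measurable fun x => ∑ j ∈ v k, (Q j).indicator (fun _ => w j ^ p) x :=
    fun k => Finset.measurable_fun_sum _ fun i _ => measurable_const.indicator (hm i)
  have hM : Measurable (finMax s Q a) := measurable_finMax hm
  calc ∫⁻ x, (∑ i ∈ s, (Q i).indicator (fun _ => w i * a i) x) ^ p ∂μ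
      ≤ ∫⁻ x, 2 * ∑' k : ℤ, (2 : ℝ≥0∞) ^ (p * k) *
        (C ^ p * ∑ j ∈ v k, (Q j).indicator (fun _ => w j ^ p) x) ∂μ := lintegral_mono hsum
    _ = 2 * ∑' k : ℤ, (2 : ℝ≥0∞) ^ (p * k) *
        (C ^ p * ∫⁻ x, ∑ j ∈ v k, (Q j).indicator (fun _ => w j ^ p) x ∂μ) := by
        rw [lintegral_const_mul _ (Measurable.tsum fun k =>
            ((hmeas k).const_mul _).const_mul _),
          lintegral_tsum fun k => (((hmeas k).const_mul _).const_mul _).aemeasurable]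
        congr 2 with k
        rw [lintegral_const_mul _ ((hmeas k).const_mul _), lintegral_const_mul _ (hmeas k)]
    _ ≤ 2 * ∑' k : ℤ, (2 : ℝ≥0∞) ^ (p * k) *
        (C ^ p * (K ^ p * σ {x | (2 : ℝ≥0∞) ^ (k : ℝ) < finMax s Q a x})) := by
        refine mul_le_mul_right (ENNReal.tsum_le_tsum fun k => ?_) _
        exact mul_le_mul_right (mul_le_mul_right (hlevel k) _) _
    _ = 2 * (C * K) ^ p * ∫⁻ x, ∑' k : ℤ,
          (if (2 : ℝ≥0∞) ^ (k : ℝ) < finMax s Q a x then (2 : ℝ≥0∞) ^ (p * k) else 0) ∂σ := by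
        have hms : ∀ k : ℤ, MeasurableSet {x | (2 : ℝ≥0∞) ^ (k : ℝ) < finMax s Q a x} :=
          fun k => measurableSet_lt measurable_const hM
        rw [lintegral_tsum fun k =>
          (Measurable.ite (hms k) measurable_const measurable_const).aemeasurable,
          mul_assoc, ← ENNReal.tsum_mul_left (a := (C * K) ^ p)]
        congr 2 with k
        have : ∫⁻ x, (if (2 : ℝ≥0∞) ^ (k : ℝ) < finMax s Q a x then
            (2 : ℝ≥0∞) ^ (p * k) else 0) ∂σ =
            2 ^ (p * k) * σ {x | (2 : ℝ≥0∞) ^ (k : ℝ) < finMax s Q a x} := by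
          rw [← lintegral_indicator_const (hms k)]
          simp only [Set.indicator_apply, Set.mem_ofPred_eq]
        rw [this, ENNReal.mul_rpow_of_nonneg _ _ hp.le]
        ring
    _ ≤ 2 * (C * K) ^ p * ∫⁻ x, C₁ * finMax s Q a x ^ p ∂σ :=
        mul_le_mul_right (lintegral_mono fun x => hC₁ _ (finMax_ne_top (fun i _ => ha i) x)) _
    _ = _ := by
        rw [lintegral_const_mul _ (hM.pow_const _)]
        push_cast
        ring

end Testing

/-! ### Countable families and products of averages -/

section Multilinear

variable {ι X : Type} {Q : ι → Set X} {s : Finset ι} [MeasurableSpace X]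

/-- Monotone convergence for powers of countable sums. -/
theorem lintegral_tsum_rpow_le [Countable ι] {μ : Measure X} {f : ι → X → ℝ≥0∞}
    (hf : ∀ i, Measurable (f i)) {p : ℝ} (hp : 0 < p) {B : ℝ≥0∞}
    (h : ∀ s : Finset ι, ∫⁻ x, (∑ i ∈ s, f i x) ^ p ∂μ ≤ B) :
    ∫⁻ x, (∑' i, f i x) ^ p ∂μ ≤ B := by
  have h1 : ∀ x, (∑' i, f i x) ^ p = ⨆ s : Finset ι, (∑ i ∈ s, f i x) ^ p := fun x => by
    rw [ENNReal.tsum_eq_iSup_sum]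
    exact (ENNReal.orderIsoRpow p hp).map_iSup _
  simp only [h1]
  rw [lintegral_iSup_directed]
  · exact iSup_le h
  · exact fun s => ((Finset.measurable_fun_sum s fun i _ => hf i).pow_const p).aemeasurable
  · refine Monotone.directed_le fun s t hst x => ?_
    exact ENNReal.rpow_le_rpow (Finset.sum_le_sum_of_subset hst) hp.le

/-- Hölder's inequality and Doob's maximal inequality for a product of averages. -/
theorem Laminar.lintegral_finMax_prod_le {m : ℕ} (hQ : Laminar Q)
    (hm : ∀ i, MeasurableSet (Q i)) {σ : Measure X} (hσ0 : ∀ i, σ (Q i) ≠ 0)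
    (hσ : ∀ i, σ (Q i) ≠ ⊤) {P : Fin m → ℝ} (hP : ∀ l, 1 < P l) {p : ℝ} (hp0 : 0 < p)
    (hp : 1 / p = ∑ l, 1 / P l) {F : Fin m → X → ℝ≥0∞} (hF : ∀ l, AEMeasurable (F l) σ)
    (hFt : ∀ l i, ∫⁻ x in Q i, F l x ∂σ ≠ ⊤) :
    ∫⁻ x, finMax s Q (fun i => ∏ l, ⨍⁻ y in Q i, F l y ∂σ) x ^ p ∂σ ≤
      (∏ l, ENNReal.ofReal (P l / (P l - 1)) ^ p) * ∏ l, (∫⁻ x, F l x ^ P l ∂σ) ^ (p / P l) := by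
  have hP0 : ∀ l, 0 < P l := fun l => one_pos.trans (hP l)
  set M : Fin m → X → ℝ≥0∞ := fun l => finMax s Q fun i => ⨍⁻ y in Q i, F l y ∂σ
  have hM : ∀ l, Measurable (M l) := fun l => measurable_finMax hm
  have h1 : ∀ x, finMax s Q (fun i => ∏ l, ⨍⁻ y in Q i, F l y ∂σ) x ^ p ≤
      ∏ l, (M l x ^ P l) ^ (p / P l) := fun x => by
    have h2 : ∀ l, (M l x ^ P l) ^ (p / P l) = M l x ^ p := fun l => by
      rw [← ENNReal.rpow_mul, mul_div_cancel₀ _ (hP0 l).ne']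
    simp only [h2]
    rw [ENNReal.prod_rpow_of_nonneg hp0.le]
    refine ENNReal.rpow_le_rpow (finMax_le fun i hi hx => ?_) hp0.le
    exact Finset.prod_le_prod' fun l _ =>
      le_finMax (a := fun i => ⨍⁻ y in Q i, F l y ∂σ) hi hx
  have hsum : ∑ l, p / P l = 1 := by
    rw [← mul_one_div_cancel hp0.ne', hp, Finset.mul_sum]
    exact Finset.sum_congr rfl fun l _ => by ring
  refine (lintegral_mono h1).trans ((ENNReal.lintegral_prod_norm_pow_le Finset.univ
    (fun l _ => ((hM l).pow_const _).aemeasurable) hsum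
    fun l _ => (div_pos hp0 (hP0 l)).le).trans ?_)
  rw [← Finset.prod_mul_distrib]
  refine Finset.prod_le_prod' fun l _ => ?_
  have h3 := hQ.lintegral_finMax_rpow_le (s := s) (a := fun i => ⨍⁻ y in Q i, F l y ∂σ) hm
    (fun i _ => hσ i) (fun i _ => (setLAverage_lt_top (hFt l i)).ne) (hF l)
    (fun i _ => by
      rw [setLAverage_eq]
      exact (ENNReal.div_mul_cancel (hσ0 i) (hσ i)).le) (hP l)
  refine (ENNReal.rpow_le_rpow h3 (div_pos hp0 (hP0 l)).le).trans (le_of_eq ?_)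
  rw [ENNReal.mul_rpow_of_nonneg _ _ (div_pos hp0 (hP0 l)).le, ← ENNReal.rpow_mul,
    mul_div_cancel₀ _ (hP0 l).ne']

end Multilinear

/-! ### Cubes, the density condition and the testing condition -/

section Cubes

variable {n : ℕ}

theorem Cube.toSet_eq_preimage (Q : Cube n) :
    Q.toSet = WithLp.ofLp ⁻¹'
      Set.pi Set.univ fun i => Set.Ico (Q.corner i) (Q.corner i + Q.side) := by
  ext x
  simp [Cube.toSet]

theorem Cube.measurableSet_toSet (Q : Cube n) : MeasurableSet Q.toSet := by
  rw [Q.toSet_eq_preimage]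
  exact (PiLp.volume_preserving_ofLp (Fin n)).measurable
    (MeasurableSet.univ_pi fun i => measurableSet_Ico)

theorem Cube.volume_toSet (Q : Cube n) : volume Q.toSet = ENNReal.ofReal Q.side ^ n := by
  rw [Q.toSet_eq_preimage, (PiLp.volume_preserving_ofLp (Fin n)).measure_preimage
    (MeasurableSet.univ_pi fun i => measurableSet_Ico).nullMeasurableSet, volume_pi_pi]
  simp

theorem Cube.volume_toSet_ne_zero (Q : Cube n) : volume Q.toSet ≠ 0 := by
  rw [Q.volume_toSet]
  exact pow_ne_zero _ (ENNReal.ofReal_pos.2 Q.side_pos).ne'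

theorem Cube.volume_toSet_ne_top (Q : Cube n) : volume Q.toSet ≠ ⊤ := by
  rw [Q.volume_toSet]
  exact ENNReal.pow_ne_top ENNReal.ofReal_ne_top

theorem Cube.exists_isCompact_superset (Q : Cube n) : ∃ K, IsCompact K ∧ Q.toSet ⊆ K := by
  refine ⟨WithLp.toLp 2 '' Set.pi Set.univ fun i => Set.Icc (Q.corner i) (Q.corner i + Q.side),
    (isCompact_univ_pi fun i => isCompact_Icc).image (PiLp.continuous_toLp 2 _), ?_⟩
  intro x hx
  exact ⟨x.ofLp, fun i _ => ⟨(hx i).1, (hx i).2.le⟩, rfl⟩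

theorem Cube.measure_toSet_ne_top (Q : Cube n) (μ : Measure (E n)) [IsLocallyFiniteMeasure μ] :
    μ Q.toSet ≠ ⊤ := by
  obtain ⟨K, hK, hQK⟩ := Q.exists_isCompact_superset
  exact ne_top_of_le_ne_top hK.measure_lt_top.ne (measure_mono hQK)

theorem Cube.side_le_of_subset (hn : 0 < n) {Q R : Cube n} (h : Q.toSet ⊆ R.toSet) :
    Q.side ≤ R.side := by
  have h1 := measure_mono (μ := volume) h
  rw [Q.volume_toSet, R.volume_toSet] at h1
  have h2 := (ENNReal.pow_right_strictMono hn.ne').le_iff_le.1 h1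
  exact (ENNReal.ofReal_le_ofReal_iff R.side_pos.le).1 h2

theorem Cube.ofReal_side_ne_zero (Q : Cube n) : ENNReal.ofReal Q.side ≠ 0 :=
  (ENNReal.ofReal_pos.2 Q.side_pos).ne'

/-- The density condition, without the quotient. -/
theorem Cube.side_rpow_mul_measure_le {β p : ℝ} (hp : 0 < p) {μ : Measure (E n)} (Q : Cube n) :
    (ENNReal.ofReal Q.side ^ β) ^ p * μ Q.toSet ≤ densityConst β p μ ^ p * volume Q.toSet := by
  have h : ENNReal.ofReal Q.side ^ β * (μ Q.toSet / volume Q.toSet) ^ (1 / p) ≤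
      densityConst β p μ := le_iSup (fun Q : Cube n => ENNReal.ofReal Q.side ^ β *
        (μ Q.toSet / volume Q.toSet) ^ (1 / p)) Q
  replace h := ENNReal.rpow_le_rpow h hp.le
  rw [ENNReal.mul_rpow_of_nonneg _ _ hp.le, ← ENNReal.rpow_mul (_ / _), one_div,
    inv_mul_cancel₀ hp.ne', ENNReal.rpow_one, ← mul_div_assoc] at h
  rwa [ENNReal.div_le_iff Q.volume_toSet_ne_zero Q.volume_toSet_ne_top] at h

/-- The testing condition, without the quotient. -/
theorem Cube.lintegral_fracMaximal_rpow_le {β p : ℝ} (hp : 1 < p) {μ : Measure (E n)}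
    [IsLocallyFiniteMeasure μ] (Q : Cube n) :
    ∫⁻ x in Q.toSet, fracMaximal β (μ.restrict Q.toSet) x ^ (p / (p - 1)) ≤
      kermanSawyerConst β p μ ^ (p / (p - 1)) * μ Q.toSet := by
  have hq : 0 < p / (p - 1) := div_pos (by linarith) (by linarith)
  rcases eq_or_ne (μ Q.toSet) 0 with h0 | h0
  · have : ∀ x, fracMaximal β (μ.restrict Q.toSet) x = 0 := fun x => by
      simp [fracMaximal, Measure.restrict_eq_zero.2 h0]
    simp [this, ENNReal.zero_rpow_of_pos hq]
  · have h : ((∫⁻ x in Q.toSet, fracMaximal β (μ.restrict Q.toSet) x ^ (p / (p - 1)) ∂volume) /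
        μ Q.toSet) ^ (1 / (p / (p - 1))) ≤ kermanSawyerConst β p μ :=
      le_iSup (fun Q : Cube n =>
        ((∫⁻ x in Q.toSet, fracMaximal β (μ.restrict Q.toSet) x ^ (p / (p - 1)) ∂volume) /
          μ Q.toSet) ^ (1 / (p / (p - 1)))) Q
    replace h := ENNReal.rpow_le_rpow h hq.le
    rw [← ENNReal.rpow_mul, one_div, inv_mul_cancel₀ hq.ne', ENNReal.rpow_one,
      ENNReal.div_le_iff h0 (Q.measure_toSet_ne_top μ)] at h
    exact h

theorem Cube.side_rpow_mul_le_fracMaximal {β : ℝ} {μ : Measure (E n)} {Q R : Cube n}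
    (h : Q.toSet ⊆ R.toSet) {x : E n} (hx : x ∈ Q.toSet) :
    ENNReal.ofReal Q.side ^ (β - n) * μ Q.toSet ≤ fracMaximal β (μ.restrict R.toSet) x := by
  refine le_trans (le_of_eq ?_) (le_iSup₂ (f := fun (Q : Cube n) (_ : x ∈ Q.toSet) =>
    ENNReal.ofReal Q.side ^ (β - (n : ℝ)) * μ.restrict R.toSet Q.toSet) Q hx)
  rw [Measure.restrict_apply Q.measurableSet_toSet, Set.inter_eq_left.2 h]

theorem Cube.side_rpow_sub_mul_volume (β : ℝ) (Q : Cube n) :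
    ENNReal.ofReal Q.side ^ (β - n) * volume Q.toSet = ENNReal.ofReal Q.side ^ β := by
  rw [Q.volume_toSet, ← ENNReal.rpow_natCast,
    ← ENNReal.rpow_add _ _ Q.ofReal_side_ne_zero ENNReal.ofReal_ne_top, sub_add_cancel]

/-- Testing a cube against itself shows that the density constant is at most the
Kerman-Sawyer constant. -/
theorem densityConst_le_kermanSawyerConst {β p : ℝ} (hp : 1 < p) (μ : Measure (E n))
    [IsLocallyFiniteMeasure μ] : densityConst β p μ ≤ kermanSawyerConst β p μ := by
  have hp0 : 0 < p := by linarith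
  have hpq : p.HolderConjugate (p / (p - 1)) := Real.HolderConjugate.conjExponent hp
  set q := p / (p - 1)
  have hq := hpq.symm.pos
  refine iSup_le fun Q => ?_
  set L := ENNReal.ofReal Q.side
  set A := kermanSawyerConst β p μ
  have hv0 := Q.volume_toSet_ne_zero
  have hvt := Q.volume_toSet_ne_top
  rcases eq_or_ne (μ Q.toSet) 0 with h0 | h0
  · rw [h0, ENNReal.zero_div, ENNReal.zero_rpow_of_pos (by positivity), mul_zero]
    exact zero_le
  have hμt := Q.measure_toSet_ne_top μ
  have h1 : (L ^ (β - n) * μ Q.toSet) ^ q * volume Q.toSet ≤ A ^ q * μ Q.toSet := by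
    refine le_trans ?_ (Q.lintegral_fracMaximal_rpow_le (β := β) hp)
    rw [← setLIntegral_const]
    refine setLIntegral_mono' Q.measurableSet_toSet fun x hx => ?_
    exact ENNReal.rpow_le_rpow (Cube.side_rpow_mul_le_fracMaximal subset_rfl hx) hq.le
  have h2 : L ^ (β - n) = L ^ β / volume Q.toSet := by
    rw [ENNReal.eq_div_iff hv0 hvt, mul_comm]
    exact Q.side_rpow_sub_mul_volume β
  set D := μ Q.toSet / volume Q.toSet
  have hD0 : D ≠ 0 := ENNReal.div_ne_zero.2 ⟨h0, hvt⟩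
  have hDt : D ≠ ⊤ := ENNReal.div_ne_top hμt hv0
  have h3 : μ Q.toSet = D * volume Q.toSet := (ENNReal.div_mul_cancel hv0 hvt).symm
  have h4 : L ^ (β - n) * μ Q.toSet = L ^ β * D := by
    rw [h2, ENNReal.div_eq_inv_mul]
    simp only [D, ENNReal.div_eq_inv_mul]
    ring
  rw [h4, h3, ← mul_assoc, ENNReal.mul_le_mul_iff_left hv0 hvt] at h1
  have h5 : (L ^ β * D ^ (1 / p)) ^ q * D ≤ A ^ q * D := by
    refine le_trans (le_of_eq ?_) h1
    rw [ENNReal.mul_rpow_of_nonneg _ _ hq.le, ENNReal.mul_rpow_of_nonneg _ _ hq.le,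
      ← ENNReal.rpow_mul D, mul_assoc]
    congr 1
    nth_rw 2 [← ENNReal.rpow_one D]
    rw [← ENNReal.rpow_add _ _ hD0 hDt]
    congr 1
    have := hpq.sub_one_mul_conj
    field_simp
    linarith
  rw [ENNReal.mul_le_mul_iff_left hD0 hDt] at h5
  exact (ENNReal.rpow_le_rpow_iff hq).1 h5

end Cubes

/-! ### Shifted dyadic grids and the dyadic fractional integral -/

section Grid

variable {n m : ℕ}

/-- The offset, in units of the side length, of a coordinate of the cubes of side `2 ^ (-k)` in
the standard dyadic grid (`b = false`) or in the grid shifted by a third (`b = true`). The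
alternating sign keeps the shifted grid nested. -/
noncomputable def gridOffset (b : Bool) (k : ℤ) : ℝ := if b then (-1) ^ k / 3 else 0

/-- The index of the cell of side `2 ^ (-k)` of the grid `t` that contains `x`. -/
noncomputable def gridIdx (t : Fin n → Bool) (k : ℤ) (x : E n) : Fin n → ℤ :=
  fun c => ⌊(2 : ℝ) ^ k * x c - gridOffset (t c) k⌋

/-- The cube of side `2 ^ (-k)` and index `j` of the grid `t`, for `i = (k, j)`. The `2 ^ n`
grids `t : Fin n → Bool` are those of the one-third trick. -/
noncomputable def gridCube (t : Fin n → Bool) (i : ℤ × (Fin n → ℤ)) : Cube n where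
  corner := WithLp.toLp 2 fun c => (2 : ℝ) ^ (-i.1) * (i.2 c + gridOffset (t c) i.1)
  side := (2 : ℝ) ^ (-i.1)
  side_pos := by positivity

theorem mem_gridCube {t : Fin n → Bool} {i : ℤ × (Fin n → ℤ)} {x : E n} :
    x ∈ (gridCube t i).toSet ↔ gridIdx t i.1 x = i.2 := by
  rw [funext_iff]
  refine forall_congr' fun c => ?_
  have hr : (0 : ℝ) < 2 ^ i.1 := by positivity
  simp only [gridCube, gridIdx, Int.floor_eq_iff, zpow_neg]
  rw [inv_mul_le_iff₀ hr, ← mul_add_one, lt_inv_mul_iff₀ hr]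
  constructor <;> rintro ⟨h1, h2⟩ <;> constructor <;> linarith

theorem mem_gridCube_self (t : Fin n → Bool) (k : ℤ) (x : E n) :
    x ∈ (gridCube t (k, gridIdx t k x)).toSet := mem_gridCube.2 rfl

theorem two_mul_gridOffset_sub (b : Bool) (k : ℤ) :
    ∃ d : ℤ, 2 * gridOffset b k - gridOffset b (k + 1) = d := by
  cases b
  · exact ⟨0, by simp [gridOffset]⟩
  · rcases Int.even_or_odd k with h | h
    · exact ⟨1, by simp [gridOffset, zpow_add_one₀, h.neg_one_zpow]; norm_num⟩
    · exact ⟨-1, by simp [gridOffset, zpow_add_one₀, h.neg_one_zpow]; norm_num⟩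

theorem gridIdx_eq_of_succ {t : Fin n → Bool} {k : ℤ} {x y : E n}
    (h : gridIdx t (k + 1) x = gridIdx t (k + 1) y) : gridIdx t k x = gridIdx t k y := by
  ext c
  obtain ⟨d, hd⟩ := two_mul_gridOffset_sub (t c) k
  have key : ∀ z : E n, gridIdx t k z c = (gridIdx t (k + 1) z c - d) / 2 := fun z => by
    have h1 := Int.floor_eq_iff.1 (rfl : ⌊(2 : ℝ) ^ (k + 1) * z c - gridOffset (t c) (k + 1)⌋ = _)
    simp only [gridIdx]
    set N := ⌊(2 : ℝ) ^ (k + 1) * z c - gridOffset (t c) (k + 1)⌋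
    rw [zpow_add_one₀ two_ne_zero] at h1
    rw [Int.floor_eq_iff]
    have h2 : (2 : ℤ) * ((N - d) / 2) ≤ N - d := by omega
    have h3 : N - d + 1 ≤ (2 : ℤ) * ((N - d) / 2) + 2 := by omega
    have h2' : (2 : ℝ) * ((N - d) / 2 : ℤ) ≤ N - d := by exact_mod_cast h2
    have h3' : (N : ℝ) - d + 1 ≤ 2 * ((N - d) / 2 : ℤ) + 2 := by exact_mod_cast h3
    constructor <;> linarith [h1.1, h1.2]
  rw [key, key, h]

theorem gridIdx_eq_of_le {t : Fin n → Bool} {k k' : ℤ} (hk : k ≤ k') {x y : E n}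
    (h : gridIdx t k' x = gridIdx t k' y) : gridIdx t k x = gridIdx t k y := by
  revert h
  induction k', hk using Int.leInduction with
  | base => exact id
  | succ j _ ih => exact fun h => ih (gridIdx_eq_of_succ h)

theorem laminar_gridCube (t : Fin n → Bool) : Laminar fun i => (gridCube t i).toSet := by
  have key : ∀ i j : ℤ × (Fin n → ℤ), i.1 ≤ j.1 → (gridCube t j).toSet ⊆ (gridCube t i).toSet ∨
      Disjoint (gridCube t i).toSet (gridCube t j).toSet := fun i j hij => by
    by_cases h : Disjoint (gridCube t i).toSet (gridCube t j).toSet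
    · exact Or.inr h
    · obtain ⟨z, hzi, hzj⟩ := Set.not_disjoint_iff.1 h
      refine Or.inl fun x hx => ?_
      rw [mem_gridCube] at *
      rw [← hzi]
      exact gridIdx_eq_of_le hij (hx.trans hzj.symm)
  intro i j
  rcases le_total i.1 j.1 with h | h
  · rcases key i j h with h | h <;> tauto
  · rcases key j i h with h | h
    · tauto
    · exact Or.inr (Or.inr h.symm)

theorem ofReal_side_gridCube (t : Fin n → Bool) (i : ℤ × (Fin n → ℤ)) :
    ENNReal.ofReal (gridCube t i).side = (2 : ℝ≥0∞) ^ (-(i.1 : ℝ)) := by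
  simp only [gridCube]
  rw [← Real.rpow_intCast, ← ENNReal.ofReal_rpow_of_pos two_pos]
  simp

theorem ofReal_side_gridCube_rpow (t : Fin n → Bool) (i : ℤ × (Fin n → ℤ)) (β : ℝ) :
    ENNReal.ofReal (gridCube t i).side ^ β = (2 : ℝ≥0∞) ^ (-β * i.1) := by
  rw [ofReal_side_gridCube, ← ENNReal.rpow_mul]
  congr 1
  ring

/-- The one-third trick on the line: an interval of length less than a third meets at most one
of `ℤ` and `ℤ ± 1/3`. -/
theorem exists_gridOffset_floor_eq (k : ℤ) {u δ : ℝ} (hδ : δ < 1 / 6) :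
    ∃ b, ∀ z, |z - u| ≤ δ → ⌊z - gridOffset b k⌋ = ⌊u - gridOffset b k⌋ := by
  have hb : ∀ z, |z - u| ≤ δ → u - δ ≤ z ∧ z ≤ u + δ := fun z hz => by
    rw [abs_le] at hz
    constructor <;> linarith
  have main : ∀ (b : Bool) (N : ℤ), (N : ℝ) ≤ u - δ - gridOffset b k →
      u + δ - gridOffset b k < N + 1 →
      ∃ b, ∀ z, |z - u| ≤ δ → ⌊z - gridOffset b k⌋ = ⌊u - gridOffset b k⌋ := by
    intro b N h1 h2
    refine ⟨b, fun z hz => ?_⟩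
    have hδ0 : 0 ≤ δ := (abs_nonneg _).trans hz
    obtain ⟨h3, h4⟩ := hb z hz
    rw [Int.floor_eq_iff.2 (⟨by linarith, by linarith⟩ :
        (N : ℝ) ≤ z - gridOffset b k ∧ z - gridOffset b k < N + 1),
      Int.floor_eq_iff.2 (⟨by linarith, by linarith⟩ :
        (N : ℝ) ≤ u - gridOffset b k ∧ u - gridOffset b k < N + 1)]
  have hN1 := Int.floor_le (u + δ)
  have hN2 := Int.lt_floor_add_one (u + δ)
  set N := ⌊u + δ⌋
  by_cases h : (N : ℝ) ≤ u - δ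
  · exact main false N (by simpa [gridOffset] using h) (by simpa [gridOffset] using hN2)
  · push Not at h
    rcases Int.even_or_odd k with hk | hk
    · refine main true (N - 1) ?_ ?_ <;>
        simp only [gridOffset, hk.neg_one_zpow, if_true] <;> push_cast <;> linarith
    · refine main true N ?_ ?_ <;>
        simp only [gridOffset, hk.neg_one_zpow, if_true] <;> linarith

/-- Every ball is contained in a cube, of comparable size, of one of the `2 ^ n` grids. -/
theorem exists_gridIdx_eq_of_norm_sub_le (x : E n) {ρ : ℝ} (hρ : 0 < ρ) :
    ∃ (k : ℤ) (t : Fin n → Bool), ρ⁻¹ ≤ 12 * 2 ^ k ∧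
      ∀ y : E n, ‖x - y‖ ≤ ρ → gridIdx t k y = gridIdx t k x := by
  obtain ⟨k, hk1, hk2⟩ := exists_mem_Ico_zpow (x := 12 * ρ) (y := 2) (by positivity) (by norm_num)
  have hp : (0 : ℝ) < 2 ^ k := by positivity
  have hδ2 : (2 : ℝ) ^ (-k) * ρ < 1 / 6 := by
    rw [zpow_neg, inv_mul_lt_iff₀ hp]
    rw [zpow_add_one₀ two_ne_zero] at hk2
    linarith
  choose t ht using fun c => exists_gridOffset_floor_eq (-k) (u := (2 : ℝ) ^ (-k) * x c) hδ2
  refine ⟨-k, t, ?_, fun y hy => ?_⟩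
  · rw [zpow_neg, ← div_eq_mul_inv, le_div_iff₀ hp, inv_mul_le_iff₀ hρ]
    linarith
  · ext c
    refine ht c _ ?_
    rw [← mul_sub, abs_mul, abs_of_pos (by positivity : (0 : ℝ) < 2 ^ (-k)), abs_sub_comm]
    refine mul_le_mul_of_nonneg_left (le_trans ?_ hy) (by positivity)
    exact PiLp.norm_apply_le (x - y) c

/-- The dyadic model `∑ ℓ(Q) ^ β ∏ₗ ⨍_Q F l`, summed over the cubes `Q ∋ x` of the grid `t`, of
the multilinear fractional integral of order `β`. -/
noncomputable def dyadicFracIntegral (β : ℝ) (t : Fin n → Bool) (F : Fin m → E n → ℝ≥0∞)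
    (x : E n) : ℝ≥0∞ :=
  ∑' i : ℤ × (Fin n → ℤ), (gridCube t i).toSet.indicator
    (fun _ => (2 : ℝ≥0∞) ^ (-β * i.1) * ∏ l, ⨍⁻ y in (gridCube t i).toSet, F l y ∂volume) x

theorem measurable_dyadicFracIntegral (β : ℝ) (t : Fin n → Bool) (F : Fin m → E n → ℝ≥0∞) :
    Measurable (dyadicFracIntegral β t F) :=
  Measurable.tsum fun i => measurable_const.indicator (gridCube t i).measurableSet_toSet

theorem dyadicFracIntegral_eq_tsum (β : ℝ) (t : Fin n → Bool) (F : Fin m → E n → ℝ≥0∞)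
    (x : E n) : dyadicFracIntegral β t F x = ∑' k : ℤ, (2 : ℝ≥0∞) ^ (-β * k) *
      ∏ l, ⨍⁻ y in (gridCube t (k, gridIdx t k x)).toSet, F l y ∂volume := by
  unfold dyadicFracIntegral
  rw [ENNReal.tsum_prod']
  refine tsum_congr fun k => ?_
  rw [tsum_eq_single (gridIdx t k x)]
  · rw [Set.indicator_of_mem (mem_gridCube_self t k x)]
  · intro j hj
    exact Set.indicator_of_notMem (fun h => hj (mem_gridCube.1 h).symm) _

/-- The cubes of a grid that contain `x` have distinct scales, so their weights are summable to a
multiple of the weight of any cube containing them all. -/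
theorem exists_sum_gridCube_le (hn : 0 < n) {β : ℝ} (hβ : 0 < β) :
    ∃ C : ℝ≥0, ∀ (t : Fin n → Bool) (u : Finset (ℤ × (Fin n → ℤ))) (j : ℤ × (Fin n → ℤ))
      (x : E n), (∀ i ∈ u, x ∈ (gridCube t i).toSet ∧
        (gridCube t i).toSet ⊆ (gridCube t j).toSet) →
      ∑ i ∈ u, (2 : ℝ≥0∞) ^ (-β * i.1) ≤ C * 2 ^ (-β * j.1) := by
  classical
  obtain ⟨C, hC⟩ := exists_tsum_ge_le hβ
  refine ⟨C, fun t u j x h => le_trans ?_ (hC j.1)⟩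
  have hinj : Set.InjOn Prod.fst (u : Set (ℤ × (Fin n → ℤ))) := fun i hi i' hi' hii => by
    refine Prod.ext hii ?_
    rw [← mem_gridCube.1 (h i hi).1, ← mem_gridCube.1 (h i' hi').1, hii]
  rw [← Finset.sum_image (f := fun k : ℤ => (2 : ℝ≥0∞) ^ (-β * k)) hinj]
  refine le_trans (Finset.sum_le_sum fun k hk => ?_) (ENNReal.sum_le_tsum (u.image Prod.fst))
  obtain ⟨i, hi, rfl⟩ := Finset.mem_image.1 hk
  rw [if_pos]
  have h1 := Cube.side_le_of_subset hn (h i hi).2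
  simp only [gridCube] at h1
  have h2 := (zpow_le_zpow_iff_right₀ (by norm_num : (1 : ℝ) < 2)).1 h1
  omega

/-- The trace inequality for the dyadic fractional integral. -/
theorem exists_lintegral_dyadicFracIntegral_rpow_le (hn : 0 < n) {P : Fin m → ℝ}
    (hP : ∀ l, 1 < P l) {p β : ℝ} (hp0 : 0 < p) (hp : 1 / p = ∑ l, 1 / P l) (hβ : 0 < β) :
    ∃ C : ℝ≥0, ∀ (μ : Measure (E n)) [IsLocallyFiniteMeasure μ] (A₀ : ℝ≥0∞),
      (p ≤ 1 → A₀ = densityConst β p μ) → (1 < p → A₀ = kermanSawyerConst β p μ) →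
      ∀ (t : Fin n → Bool) (F : Fin m → E n → ℝ≥0∞), (∀ l, AEMeasurable (F l) volume) →
      (∀ l (Q : Cube n), ∫⁻ y in Q.toSet, F l y ≠ ⊤) →
      ∫⁻ x, dyadicFracIntegral β t F x ^ p ∂μ ≤
        C * A₀ ^ p * ∏ l, (∫⁻ x, F l x ^ P l) ^ (p / P l) := by
  obtain ⟨C₁, hC₁⟩ := exists_sum_gridCube_le hn hβ
  have hprod : (∏ l, ENNReal.ofReal (P l / (P l - 1)) ^ p) ≠ ⊤ :=
    ENNReal.prod_ne_top fun l _ => ENNReal.rpow_ne_top_of_nonneg hp0.le ENNReal.ofReal_ne_top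
  have key : ∃ C : ℝ≥0, ∀ (μ : Measure (E n)) [IsLocallyFiniteMeasure μ] (A₀ : ℝ≥0∞),
      (p ≤ 1 → A₀ = densityConst β p μ) → (1 < p → A₀ = kermanSawyerConst β p μ) →
      ∀ (t : Fin n → Bool) (a : ℤ × (Fin n → ℤ) → ℝ≥0∞), (∀ i, a i ≠ ⊤) →
      ∀ s : Finset (ℤ × (Fin n → ℤ)),
      ∫⁻ x, (∑ i ∈ s, (gridCube t i).toSet.indicator
          (fun _ => (2 : ℝ≥0∞) ^ (-β * i.1) * a i) x) ^ p ∂μ ≤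
        C * A₀ ^ p * ∫⁻ x, finMax s (fun i => (gridCube t i).toSet) a x ^ p := by
    rcases le_or_gt p 1 with hp1 | hp1
    · obtain ⟨C₂, hC₂⟩ := Laminar.exists_lintegral_sum_rpow_le_of_density hp0 hp1
      refine ⟨C₂ * C₁ ^ p, fun μ _ A₀ hA _ t a ha s => ?_⟩
      refine (hC₂ (laminar_gridCube t) (fun i => (gridCube t i).measurableSet_toSet) (hC₁ t)
        (K := A₀) (fun i => ?_) ha s (σ := volume)).trans (le_of_eq ?_)
      · rw [hA hp1, ← ofReal_side_gridCube_rpow t]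
        exact Cube.side_rpow_mul_measure_le hp0 _
      · rw [ENNReal.mul_rpow_of_nonneg _ _ hp0.le, ENNReal.coe_mul,
          ENNReal.coe_rpow_of_nonneg _ hp0.le]
        ring
    · refine ⟨(C₁ * p.toNNReal) ^ p, fun μ _ A₀ _ hA t a ha s => ?_⟩
      have hA' := hA hp1
      refine ((laminar_gridCube t).lintegral_sum_rpow_le_of_testing (σ := volume) (K := A₀)
        (q := p / (p - 1)) (s := s) (w := fun i => (2 : ℝ≥0∞) ^ (-β * i.1))
        (κ := fun i => ENNReal.ofReal (gridCube t i).side ^ (β - n))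
        (H := fun j => fracMaximal β (μ.restrict (gridCube t j).toSet))
        (fun i => (gridCube t i).measurableSet_toSet) (fun i => ?_) (fun i => ?_) (hC₁ t)
        (fun i j hij x hx => Cube.side_rpow_mul_le_fracMaximal hij hx)
        (Real.HolderConjugate.conjExponent hp1) (fun j => ?_)
        (fun i => (gridCube t i).measure_toSet_ne_top μ) ha).trans (le_of_eq ?_)
      · rw [Cube.side_rpow_sub_mul_volume, ofReal_side_gridCube_rpow]
      · exact ENNReal.rpow_ne_top_of_ne_zero (by norm_num) (by norm_num)
      · rw [hA']
        exact Cube.lintegral_fracMaximal_rpow_le hp1 _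
      · rw [ENNReal.mul_rpow_of_nonneg _ _ hp0.le, ENNReal.coe_rpow_of_nonneg _ hp0.le,
          ENNReal.coe_mul]
        rfl
  obtain ⟨C, hC⟩ := key
  refine ⟨C * (∏ l, ENNReal.ofReal (P l / (P l - 1)) ^ p).toNNReal,
    fun μ _ A₀ hA hA' t F hF hFt => ?_⟩
  refine lintegral_tsum_rpow_le
    (fun i => measurable_const.indicator (gridCube t i).measurableSet_toSet) hp0 fun s => ?_
  refine (hC μ A₀ hA hA' t _ (fun i => ENNReal.prod_ne_top fun l _ =>
    (setLAverage_lt_top (hFt l _)).ne) s).trans ?_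
  refine (mul_le_mul_right ((laminar_gridCube t).lintegral_finMax_prod_le
    (fun i => (gridCube t i).measurableSet_toSet) (fun i => (gridCube t i).volume_toSet_ne_zero)
    (fun i => (gridCube t i).volume_toSet_ne_top) hP hp0 hp hF fun l i => hFt l _) _).trans
    (le_of_eq ?_)
  rw [ENNReal.coe_mul, ENNReal.coe_toNNReal hprod]
  ring

end Grid

/-! ### Pointwise domination and interpolation between the orders -/

section Pointwise

variable {n m : ℕ}

/-- Tonelli's theorem for a product of functions of separate variables. -/
theorem lintegral_fin_prod_eq_prod {X : Type*} [MeasureSpace X]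
    [SigmaFinite (volume : Measure X)] {F : Fin m → X → ℝ≥0∞}
    (hF : ∀ l, AEMeasurable (F l) volume) :
    ∫⁻ y : Fin m → X, ∏ l, F l (y l) = ∏ l, ∫⁻ x, F l x := by
  induction m with
  | zero => simp [volume_pi]
  | succ m ih =>
    have hmp := (volume_preserving_piFinSuccAbove (fun _ : Fin (m + 1) => X) 0).symm
    rw [← hmp.lintegral_comp_emb (MeasurableEquiv.measurableEmbedding _), Fin.prod_univ_succ,
      ← ih fun l => hF l.succ]
    simp_rw [MeasurableEquiv.piFinSuccAbove_symm_apply, Fin.insertNthEquiv,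
      Fin.prod_univ_succ, Fin.insertNth_zero, Equiv.coe_fn_mk, Fin.cons_succ, Fin.cons_zero]
    have h2 : AEMeasurable (fun y : Fin m → X => ∏ l, F l.succ (y l)) volume :=
      Finset.aemeasurable_fun_prod _ fun l _ =>
        (hF l.succ).comp_quasiMeasurePreserving (Measure.quasiMeasurePreserving_eval _ l)
    exact lintegral_prod_mul (hF 0) h2

/-- The kernel of the fractional integral is dominated by its dyadic models. -/
theorem enorm_fracIntegrand_le {α : ℝ} (hα : α < (m : ℝ) * n) (f : Fin m → E n → ℂ) (x : E n)
    (y : Fin m → E n) :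
    ‖fracIntegrand α f x y‖ₑ ≤ (12 : ℝ≥0∞) ^ ((m : ℝ) * n - α) *
      ∑ t : Fin n → Bool, ∑' k : ℤ, (2 : ℝ≥0∞) ^ (((m : ℝ) * n - α) * k) *
        ∏ l, (gridCube t (k, gridIdx t k x)).toSet.indicator (fun z => ‖f l z‖ₑ) (y l) := by
  set γ := (m : ℝ) * n - α
  have hγ : 0 < γ := by simp only [γ]; linarith
  set ρ := ∑ l, ‖x - y l‖
  have hρ : 0 ≤ ρ := Finset.sum_nonneg fun l _ => norm_nonneg _
  rcases hρ.eq_or_lt with h0 | h0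
  -- on the diagonal the quotient is `0`, by the convention for division by zero
  · have : fracIntegrand α f x y = 0 := by
      simp only [fracIntegrand]
      change _ / ((ρ ^ γ : ℝ) : ℂ) = 0
      rw [← h0, Real.zero_rpow hγ.ne']
      simp
    simp [this]
  obtain ⟨k, t, hk, ht⟩ := exists_gridIdx_eq_of_norm_sub_le x h0
  have h1 : ‖fracIntegrand α f x y‖ₑ = (∏ l, ‖f l (y l)‖ₑ) * ENNReal.ofReal (ρ⁻¹ ^ γ) := by
    rw [← ofReal_norm]
    simp only [fracIntegrand]
    change ENNReal.ofReal ‖_ / ((ρ ^ γ : ℝ) : ℂ)‖ = _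
    rw [norm_div, norm_prod, Complex.norm_real, Real.norm_of_nonneg (by positivity),
      div_eq_mul_inv, ← Real.inv_rpow hρ, ENNReal.ofReal_mul
        (Finset.prod_nonneg fun _ _ => norm_nonneg _),
      ENNReal.ofReal_prod_of_nonneg fun _ _ => norm_nonneg _]
    simp only [ofReal_norm]
  have h2 : ENNReal.ofReal (ρ⁻¹ ^ γ) ≤ (12 : ℝ≥0∞) ^ γ * 2 ^ (γ * k) := by
    rw [mul_comm γ, ENNReal.rpow_mul, ← ENNReal.mul_rpow_of_nonneg _ _ hγ.le,
      ← ENNReal.ofReal_rpow_of_nonneg (inv_nonneg.2 hρ) hγ.le]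
    refine ENNReal.rpow_le_rpow ((ENNReal.ofReal_le_ofReal hk).trans (le_of_eq ?_)) hγ.le
    rw [ENNReal.ofReal_mul (by norm_num), ← Real.rpow_intCast,
      ← ENNReal.ofReal_rpow_of_pos two_pos]
    simp
  have h3 : ∀ l, (gridCube t (k, gridIdx t k x)).toSet.indicator (fun z => ‖f l z‖ₑ) (y l) =
      ‖f l (y l)‖ₑ := fun l => by
    refine Set.indicator_of_mem (mem_gridCube.2 (ht _ ?_)) _
    exact Finset.single_le_sum (f := fun l => ‖x - y l‖) (fun _ _ => norm_nonneg _)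
      (Finset.mem_univ l)
  calc ‖fracIntegrand α f x y‖ₑ ≤ (∏ l, ‖f l (y l)‖ₑ) * ((12 : ℝ≥0∞) ^ γ * 2 ^ (γ * k)) := by
        rw [h1]
        exact mul_le_mul_right h2 _
    _ = (12 : ℝ≥0∞) ^ γ * (2 ^ (γ * k) * ∏ l,
        (gridCube t (k, gridIdx t k x)).toSet.indicator (fun z => ‖f l z‖ₑ) (y l)) := by
        simp only [h3]
        ring
    _ ≤ _ := by
        refine mul_le_mul_right ?_ _
        refine le_trans ?_ (Finset.single_le_sum (f := fun t : Fin n → Bool =>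
          ∑' k : ℤ, (2 : ℝ≥0∞) ^ (γ * k) * ∏ l,
            (gridCube t (k, gridIdx t k x)).toSet.indicator (fun z => ‖f l z‖ₑ) (y l))
          (fun _ _ => zero_le) (Finset.mem_univ t))
        exact ENNReal.le_tsum k

theorem setLAverage_gridCube (t : Fin n → Bool) (i : ℤ × (Fin n → ℤ)) (F : E n → ℝ≥0∞) :
    ⨍⁻ y in (gridCube t i).toSet, F y ∂volume =
      (2 : ℝ≥0∞) ^ ((n : ℝ) * i.1) * ∫⁻ y in (gridCube t i).toSet, F y := by
  rw [setLAverage_eq, ENNReal.div_eq_inv_mul, Cube.volume_toSet, ofReal_side_gridCube,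
    ← ENNReal.rpow_natCast, ← ENNReal.rpow_mul, ← ENNReal.rpow_neg]
  congr 2
  ring

theorem lintegral_enorm_fracIntegrand_le {α : ℝ} (hα : α < (m : ℝ) * n) {f : Fin m → E n → ℂ}
    (hf : ∀ l, AEStronglyMeasurable (f l) volume) (x : E n) :
    ∫⁻ y, ‖fracIntegrand α f x y‖ₑ ≤ (12 : ℝ≥0∞) ^ ((m : ℝ) * n - α) *
      ∑ t : Fin n → Bool, dyadicFracIntegral α t (fun l z => ‖f l z‖ₑ) x := by
  have hG : ∀ (S : Set (E n)), MeasurableSet S → ∀ l,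
      AEMeasurable (S.indicator fun z => ‖f l z‖ₑ) volume := fun S hS l =>
    (hf l).enorm.indicator hS
  have hGp : ∀ (S : Set (E n)), MeasurableSet S →
      AEMeasurable (fun y : Fin m → E n => ∏ l, S.indicator (fun z => ‖f l z‖ₑ) (y l)) volume :=
    fun S hS => Finset.aemeasurable_fun_prod _ fun l _ =>
      (hG S hS l).comp_quasiMeasurePreserving (Measure.quasiMeasurePreserving_eval _ l)
  have hms : ∀ t k, MeasurableSet (gridCube t (k, gridIdx t k x)).toSet := fun t k =>
    Cube.measurableSet_toSet _
  refine (lintegral_mono fun y => enorm_fracIntegrand_le hα f x y).trans (le_of_eq ?_)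
  rw [lintegral_const_mul' _ _ (ENNReal.rpow_ne_top_of_ne_zero (by norm_num) (by norm_num)),
    lintegral_finsetSum' _ fun t _ => AEMeasurable.tsum fun k =>
      (hGp _ (hms t k)).const_mul _]
  congr 1
  refine Finset.sum_congr rfl fun t _ => ?_
  rw [lintegral_tsum fun k => (hGp _ (hms t k)).const_mul _, dyadicFracIntegral_eq_tsum]
  refine tsum_congr fun k => ?_
  rw [lintegral_const_mul'' _ (hGp _ (hms t k)), lintegral_fin_prod_eq_prod (hG _ (hms t k))]
  simp only [lintegral_indicator (hms t k), setLAverage_gridCube]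
  rw [Finset.prod_mul_distrib, ← mul_assoc]
  congr 1
  rw [Finset.prod_const, Finset.card_univ, Fintype.card_fin, ← ENNReal.rpow_natCast,
    ← ENNReal.rpow_mul, ← ENNReal.rpow_add _ _ (by norm_num) (by norm_num)]
  congr 1
  ring

theorem laverage_le_rpow {X : Type*} [MeasurableSpace X] {ν : Measure X} [IsProbabilityMeasure ν]
    {F : X → ℝ≥0∞} (hF : AEMeasurable F ν) {r : ℝ} (hr : 1 < r) :
    ∫⁻ x, F x ∂ν ≤ (∫⁻ x, F x ^ r ∂ν) ^ (1 / r) := by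
  have h := ENNReal.lintegral_mul_le_Lp_mul_Lq ν (Real.HolderConjugate.conjExponent hr) hF
    (aemeasurable_const (b := (1 : ℝ≥0∞)))
  simpa using h

/-- Hölder's inequality bounds the product of averages by the product Morrey norm. -/
theorem prod_setLAverage_le {P : Fin m → ℝ} (hP : ∀ l, 1 < P l) (p₀ : ℝ) {f : Fin m → E n → ℂ}
    (hf : ∀ l, AEStronglyMeasurable (f l) volume) (Q : Cube n) :
    ∏ l, ⨍⁻ y in Q.toSet, ‖f l y‖ₑ ∂volume ≤
      volume Q.toSet ^ (-(1 / p₀)) * prodMorreyNorm P p₀ f := by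
  have hv0 := Q.volume_toSet_ne_zero
  have hvt := Q.volume_toSet_ne_top
  have h1 : volume Q.toSet ^ (1 / p₀) * ∏ l, ⨍⁻ y in Q.toSet, ‖f l y‖ₑ ∂volume ≤
      prodMorreyNorm P p₀ f := by
    refine le_trans (mul_le_mul_right (Finset.prod_le_prod' fun l _ => ?_) _)
      (le_iSup (fun Q : Cube n => volume Q.toSet ^ (1 / p₀) *
        ∏ i, (⨍⁻ y in Q.toSet, ‖f i y‖ₑ ^ (P i) ∂volume) ^ (1 / P i)) Q)
    have : IsProbabilityMeasure ((volume Q.toSet)⁻¹ • volume.restrict Q.toSet) :=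
      ⟨by simp [ENNReal.inv_mul_cancel hv0 hvt]⟩
    rw [setLAverage_eq', setLAverage_eq']
    exact laverage_le_rpow (((hf l).enorm.restrict).smul_measure _) (hP l)
  refine le_trans (le_of_eq ?_) (mul_le_mul_right h1 _)
  rw [← mul_assoc, ← ENNReal.rpow_add _ _ hv0 hvt, neg_add_cancel, ENNReal.rpow_zero, one_mul]

/-- The same bound for the cells of a grid, in terms of the scale. -/
theorem prod_setLAverage_gridCube_le {P : Fin m → ℝ} (hP : ∀ l, 1 < P l) (p₀ : ℝ)
    {f : Fin m → E n → ℂ} (hf : ∀ l, AEStronglyMeasurable (f l) volume) (t : Fin n → Bool)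
    (i : ℤ × (Fin n → ℤ)) :
    ∏ l, ⨍⁻ y in (gridCube t i).toSet, ‖f l y‖ₑ ∂volume ≤
      (2 : ℝ≥0∞) ^ (n / p₀ * i.1) * prodMorreyNorm P p₀ f := by
  refine (prod_setLAverage_le hP p₀ hf _).trans (le_of_eq ?_)
  rw [Cube.volume_toSet, ofReal_side_gridCube, ← ENNReal.rpow_natCast, ← ENNReal.rpow_mul,
    ← ENNReal.rpow_mul]
  congr 2
  ring

/-- Interpolation of Hedberg type: sums of order `α` are controlled by sums of order `β ≤ α` and
a growth bound of order `ν > α`. -/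
theorem exists_tsum_le_rpow_mul_rpow {α β ν : ℝ} (hβα : β ≤ α) (hαν : α < ν) :
    ∃ C : ℝ≥0, ∀ (a : ℤ → ℝ≥0∞) (N : ℝ≥0∞), N ≠ ⊤ → (∀ k : ℤ, a k ≤ 2 ^ (ν * k) * N) →
      ∑' k : ℤ, (2 : ℝ≥0∞) ^ (-α * k) * a k ≤
        C * ((∑' k : ℤ, (2 : ℝ≥0∞) ^ (-β * k) * a k) ^ ((ν - α) / (ν - β)) *
          N ^ ((α - β) / (ν - β))) := by
  have h2 : ∀ r : ℝ, (2 : ℝ≥0∞) ^ r ≠ 0 := fun r => by simp [ENNReal.rpow_eq_zero_iff]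
  have hνβ : 0 < ν - β := by linarith
  have hνα : 0 < ν - α := by linarith
  obtain ⟨C, hC⟩ := exists_tsum_two_rpow_lt_le hνα
  refine ⟨C + 1, fun a N hN ha => ?_⟩
  set b := ∑' k : ℤ, (2 : ℝ≥0∞) ^ (-β * k) * a k
  by_cases hzero : ∀ k, a k = 0
  · simp [hzero]
  have hN0 : N ≠ 0 := by
    rintro rfl
    exact hzero fun k => by simpa using ha k
  have hb0 : b ≠ 0 := fun hb => hzero fun k => by
    have := ENNReal.tsum_eq_zero.1 hb k
    simpa [h2] using this
  rcases eq_or_ne b ⊤ with hbt | hbt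
  · rw [hbt, ENNReal.top_rpow_of_pos (by positivity), ENNReal.top_mul, ENNReal.mul_top]
    · exact le_top
    · simp
    · simp [ENNReal.rpow_eq_zero_iff, hN0, hN]
  -- the two bounds for a summand agree at the scale `2 ^ k = R`
  set D := b / N
  have hD0 : D ≠ 0 := ENNReal.div_ne_zero.2 ⟨hb0, hN⟩
  have hDt : D ≠ ⊤ := ENNReal.div_ne_top hbt hN0
  have hbD : b = D * N := (ENNReal.div_mul_cancel hN0 hN).symm
  set R := D ^ (1 / (ν - β))
  have hR0 : R ≠ 0 := by simp [R, ENNReal.rpow_eq_zero_iff, hD0, hDt]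
  have hRt : R ≠ ⊤ := ENNReal.rpow_ne_top_of_nonneg (by positivity) hDt
  have hexp : 1 - (α - β) / (ν - β) = (ν - α) / (ν - β) := by field_simp; ring
  have hgoal : b ^ ((ν - α) / (ν - β)) * N ^ ((α - β) / (ν - β)) =
      D ^ ((ν - α) / (ν - β)) * N := by
    rw [hbD, ENNReal.mul_rpow_of_nonneg _ _ (by positivity), mul_assoc,
      ← ENNReal.rpow_add _ _ hN0 hN]
    have : (ν - α) / (ν - β) + (α - β) / (ν - β) = 1 := by linarith
    rw [this, ENNReal.rpow_one]
  have hlow : ∀ k : ℤ, (2 : ℝ≥0∞) ^ (-α * k) * a k ≤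
      2 ^ ((ν - α) * k) * N := fun k => by
    refine (mul_le_mul_right (ha k) _).trans (le_of_eq ?_)
    rw [← mul_assoc, ← ENNReal.rpow_add _ _ (by norm_num) (by norm_num)]
    congr 2
    ring
  have hhigh : ∀ k : ℤ, ¬ (2 : ℝ≥0∞) ^ (k : ℝ) < R → (2 : ℝ≥0∞) ^ (-α * k) * a k ≤
      R ^ (-(α - β)) * (2 ^ (-β * k) * a k) := fun k hk => by
    have h3 : (2 : ℝ≥0∞) ^ (-α * k) = 2 ^ (-(α - β) * k) * 2 ^ (-β * k) := by
      rw [← ENNReal.rpow_add _ _ (by norm_num) (by norm_num)]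
      congr 1
      ring
    rw [h3, mul_assoc]
    refine mul_le_mul_left ?_ _
    rw [mul_comm, ENNReal.rpow_mul, ENNReal.rpow_neg, ENNReal.rpow_neg]
    exact ENNReal.inv_le_inv.2 (ENNReal.rpow_le_rpow (not_lt.1 hk) (by linarith))
  calc ∑' k : ℤ, (2 : ℝ≥0∞) ^ (-α * k) * a k
      ≤ ∑' k : ℤ, ((if (2 : ℝ≥0∞) ^ (k : ℝ) < R then (2 : ℝ≥0∞) ^ ((ν - α) * k) else 0) * N +
          R ^ (-(α - β)) * (2 ^ (-β * k) * a k)) := by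
        refine ENNReal.tsum_le_tsum fun k => ?_
        split_ifs with h
        · exact le_add_right (hlow k)
        · rw [zero_mul, zero_add]
          exact hhigh k h
    _ = (∑' k : ℤ, (if (2 : ℝ≥0∞) ^ (k : ℝ) < R then (2 : ℝ≥0∞) ^ ((ν - α) * k) else 0)) * N +
          R ^ (-(α - β)) * b := by
        rw [ENNReal.tsum_add, ENNReal.tsum_mul_right, ENNReal.tsum_mul_left]
    _ ≤ C * R ^ (ν - α) * N + R ^ (-(α - β)) * b :=
        add_le_add_left (mul_le_mul_left (hC R hRt) _) _
    _ = C * (D ^ ((ν - α) / (ν - β)) * N) + D ^ ((ν - α) / (ν - β)) * N := by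
        have h4 : R ^ (ν - α) = D ^ ((ν - α) / (ν - β)) := by
          simp only [R]
          rw [← ENNReal.rpow_mul]
          congr 1
          ring
        have h5 : R ^ (-(α - β)) * D = D ^ ((ν - α) / (ν - β)) := by
          simp only [R]
          rw [← ENNReal.rpow_mul]
          nth_rw 2 [← ENNReal.rpow_one D]
          rw [← ENNReal.rpow_add _ _ hD0 hDt, ← hexp]
          congr 1
          ring
        rw [h4, hbD, ← mul_assoc (R ^ _), h5, mul_assoc]
    _ = _ := by
        rw [hgoal, ENNReal.coe_add, ENNReal.coe_one]
        ring

/-- The dyadic fractional integral of order `α` is controlled by that of order `β ≤ α` and the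
product Morrey norm. -/
theorem exists_dyadicFracIntegral_le {P : Fin m → ℝ} (hP : ∀ l, 1 < P l) {p₀ α β : ℝ}
    (hβα : β ≤ α) (hα : α < n / p₀) :
    ∃ C : ℝ≥0, ∀ (t : Fin n → Bool) (f : Fin m → E n → ℂ),
      (∀ l, AEStronglyMeasurable (f l) volume) → prodMorreyNorm P p₀ f ≠ ⊤ → ∀ x,
      dyadicFracIntegral α t (fun l z => ‖f l z‖ₑ) x ≤
        C * (dyadicFracIntegral β t (fun l z => ‖f l z‖ₑ) x ^ ((n / p₀ - α) / (n / p₀ - β)) *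
          prodMorreyNorm P p₀ f ^ ((α - β) / (n / p₀ - β))) := by
  obtain ⟨C, hC⟩ := exists_tsum_le_rpow_mul_rpow hβα hα
  refine ⟨C, fun t f hf hN x => ?_⟩
  simp only [dyadicFracIntegral_eq_tsum]
  exact hC _ _ hN fun k => prod_setLAverage_gridCube_le hP p₀ hf t _

end Pointwise

/-! ### Small and large scales on a cube -/

section Local

variable {n m : ℕ}

/-- The cube with the same centre as `Q` and three times its side length. -/
noncomputable def Cube.triple (Q : Cube n) : Cube n where
  corner := WithLp.toLp 2 fun c => Q.corner c - Q.side
  side := 3 * Q.side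
  side_pos := mul_pos three_pos Q.side_pos

theorem Cube.subset_triple {Q R : Cube n} {x : E n} (hQ : x ∈ Q.toSet) (hR : x ∈ R.toSet)
    (h : R.side ≤ Q.side) : R.toSet ⊆ Q.triple.toSet := fun y hy c => by
  have h1 := hQ c
  have h2 := hR c
  have h3 := hy c
  simp only [Cube.triple]
  constructor <;> linarith [h1.1, h1.2, h2.1, h2.2, h3.1, h3.2]

theorem Cube.volume_triple (Q : Cube n) : volume Q.triple.toSet = 3 ^ n * volume Q.toSet := by
  rw [Cube.volume_toSet, Cube.volume_toSet, ← mul_pow]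
  simp only [Cube.triple]
  rw [ENNReal.ofReal_mul three_pos.le]
  simp

/-- On a cube `Q`, only the scales above `ℓ(Q)` see the functions outside the triple of `Q`, and
they contribute no more than the Morrey norm allows at the scale of `Q`. -/
theorem exists_dyadicFracIntegral_le_local {P : Fin m → ℝ} (hP : ∀ l, 1 < P l) {p₀ β : ℝ}
    (hβ : β < n / p₀) :
    ∃ C : ℝ≥0, ∀ (t : Fin n → Bool) (f : Fin m → E n → ℂ),
      (∀ l, AEStronglyMeasurable (f l) volume) → ∀ (Q : Cube n), ∀ x ∈ Q.toSet,
      dyadicFracIntegral β t (fun l z => ‖f l z‖ₑ) x ≤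
        dyadicFracIntegral β t (fun l => Q.triple.toSet.indicator fun z => ‖f l z‖ₑ) x +
          C * (ENNReal.ofReal Q.side ^ (β - n / p₀) * prodMorreyNorm P p₀ f) := by
  obtain ⟨C, hC⟩ := exists_tsum_two_rpow_lt_le (sub_pos.2 hβ)
  refine ⟨C, fun t f hf Q x hx => ?_⟩
  set L := ENNReal.ofReal Q.side
  set N := prodMorreyNorm P p₀ f
  have hL0 : L ≠ 0 := Q.ofReal_side_ne_zero
  simp only [dyadicFracIntegral_eq_tsum]
  calc ∑' k : ℤ, (2 : ℝ≥0∞) ^ (-β * k) *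
        ∏ l, ⨍⁻ y in (gridCube t (k, gridIdx t k x)).toSet, ‖f l y‖ₑ ∂volume
      ≤ ∑' k : ℤ, ((2 : ℝ≥0∞) ^ (-β * k) *
        ∏ l, ⨍⁻ y in (gridCube t (k, gridIdx t k x)).toSet,
          Q.triple.toSet.indicator (fun z => ‖f l z‖ₑ) y ∂volume +
        (if (2 : ℝ≥0∞) ^ (k : ℝ) < L⁻¹ then (2 : ℝ≥0∞) ^ ((n / p₀ - β) * k) else 0) * N) := by
        refine ENNReal.tsum_le_tsum fun k => ?_
        split_ifs with h
        · refine le_add_left ((mul_le_mul_right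
            (prod_setLAverage_gridCube_le hP p₀ hf t _) _).trans (le_of_eq ?_))
          rw [← mul_assoc, ← ENNReal.rpow_add _ _ (by norm_num) (by norm_num)]
          congr 2
          ring
        · refine le_add_right (le_of_eq ?_)
          have hside : (gridCube t (k, gridIdx t k x)).side ≤ Q.side := by
            rw [← ENNReal.ofReal_le_ofReal_iff Q.side_pos.le, ofReal_side_gridCube,
              ENNReal.rpow_neg, ENNReal.inv_le_iff_inv_le]
            exact not_lt.1 h
          have hsub := Cube.subset_triple hx (mem_gridCube_self t k x) hside
          congr 1
          refine Finset.prod_congr rfl fun l _ => ?_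
          rw [setLAverage_eq, setLAverage_eq]
          congr 1
          refine setLIntegral_congr_fun (Cube.measurableSet_toSet _) fun y hy => ?_
          exact (Set.indicator_of_mem (hsub hy) (fun z => ‖f l z‖ₑ)).symm
    _ ≤ _ := by
        rw [ENNReal.tsum_add, ENNReal.tsum_mul_right]
        refine add_le_add_right ?_ _
        refine (mul_le_mul_left (hC _ (ENNReal.inv_ne_top.2 hL0)) _).trans (le_of_eq ?_)
        rw [ENNReal.inv_rpow, ← ENNReal.rpow_neg, neg_sub, mul_assoc]

theorem prod_rpow_eq_rpow_sum {κ : Type*} {s : Finset κ} {v : ℝ≥0∞} (hv0 : v ≠ 0)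
    (hvt : v ≠ ⊤) (r : κ → ℝ) : ∏ l ∈ s, v ^ r l = v ^ ∑ l ∈ s, r l := by
  classical
  induction s using Finset.induction_on with
  | empty => simp
  | insert i s hi ih =>
    rw [Finset.prod_insert hi, Finset.sum_insert hi, ih, ENNReal.rpow_add _ _ hv0 hvt]

/-- The product of the `L ^ P l` norms on a cube in terms of the product Morrey norm. -/
theorem prod_lintegral_rpow_le {P : Fin m → ℝ} (hP : ∀ l, 1 < P l) {p p₀ : ℝ} (hp0 : 0 < p)
    (hp : 1 / p = ∑ l, 1 / P l) (f : Fin m → E n → ℂ) (Q : Cube n) :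
    ∏ l, (∫⁻ y in Q.toSet, ‖f l y‖ₑ ^ P l) ^ (p / P l) ≤
      volume Q.toSet ^ (1 - p / p₀) * prodMorreyNorm P p₀ f ^ p := by
  have hv0 := Q.volume_toSet_ne_zero
  have hvt := Q.volume_toSet_ne_top
  have hP0 : ∀ l, 0 < P l := fun l => one_pos.trans (hP l)
  have h1 : volume Q.toSet ^ (1 / p₀) *
      ∏ i, (⨍⁻ y in Q.toSet, ‖f i y‖ₑ ^ (P i) ∂volume) ^ (1 / P i) ≤ prodMorreyNorm P p₀ f :=
    le_iSup (fun Q : Cube n => volume Q.toSet ^ (1 / p₀) *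
      ∏ i, (⨍⁻ y in Q.toSet, ‖f i y‖ₑ ^ (P i) ∂volume) ^ (1 / P i)) Q
  have hsum : ∑ l, p / P l = 1 := by
    rw [← mul_one_div_cancel hp0.ne', hp, Finset.mul_sum]
    exact Finset.sum_congr rfl fun l _ => by ring
  have h2 : ∀ l, (∫⁻ y in Q.toSet, ‖f l y‖ₑ ^ P l) ^ (p / P l) =
      volume Q.toSet ^ (p / P l) *
        ((⨍⁻ y in Q.toSet, ‖f l y‖ₑ ^ (P l) ∂volume) ^ (1 / P l)) ^ p := fun l => by
    rw [← ENNReal.rpow_mul (⨍⁻ y in Q.toSet, ‖f l y‖ₑ ^ (P l) ∂volume), one_div_mul_eq_div,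
      ← ENNReal.mul_rpow_of_nonneg _ _ (div_pos hp0 (hP0 l)).le, setLAverage_eq,
      ENNReal.mul_div_cancel hv0 hvt]
  simp only [h2]
  rw [Finset.prod_mul_distrib, ENNReal.prod_rpow_of_nonneg hp0.le,
    prod_rpow_eq_rpow_sum hv0 hvt, hsum]
  refine le_trans (le_of_eq ?_) (mul_le_mul_right (ENNReal.rpow_le_rpow h1 hp0.le) _)
  rw [ENNReal.mul_rpow_of_nonneg _ _ hp0.le, ← mul_assoc, ← ENNReal.rpow_mul,
    ← ENNReal.rpow_add _ _ hv0 hvt]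
  congr 2
  ring

end Local

/-! ### The Morrey estimate and measurability -/

section Trace

variable {n m : ℕ}

/-- The Morrey form of the trace inequality for the dyadic fractional integral. -/
theorem exists_setLIntegral_dyadicFracIntegral_rpow_le (hn : 0 < n) {P : Fin m → ℝ}
    (hP : ∀ l, 1 < P l) {p p₀ β : ℝ} (hp0 : 0 < p) (hp : 1 / p = ∑ l, 1 / P l) (hβ : 0 < β)
    (hpp₀ : p ≤ p₀) (hβn : β < n / p₀) :
    ∃ C : ℝ≥0, ∀ (μ : Measure (E n)) [IsLocallyFiniteMeasure μ] (A₀ : ℝ≥0∞),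
      (p ≤ 1 → A₀ = densityConst β p μ) → (1 < p → A₀ = kermanSawyerConst β p μ) →
      ∀ (t : Fin n → Bool) (f : Fin m → E n → ℂ), (∀ l, LocallyIntegrable (f l) volume) →
      ∀ Q : Cube n,
      ∫⁻ x in Q.toSet, dyadicFracIntegral β t (fun l z => ‖f l z‖ₑ) x ^ p ∂μ ≤
        C * A₀ ^ p * (volume Q.toSet ^ (1 - p / p₀) * prodMorreyNorm P p₀ f ^ p) := by
  have hp₀ : 0 < p₀ := hp0.trans_le hpp₀
  have hexp : 0 ≤ 1 - p / p₀ := by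
    rw [sub_nonneg, div_le_one hp₀]
    exact hpp₀
  obtain ⟨C₁, hC₁⟩ := exists_lintegral_dyadicFracIntegral_rpow_le hn hP hp0 hp hβ
  obtain ⟨C₂, hC₂⟩ := exists_dyadicFracIntegral_le_local (m := m) hP hβn
  have h3t : ((3 : ℝ≥0∞) ^ n) ^ (1 - p / p₀) ≠ ⊤ :=
    ENNReal.rpow_ne_top_of_nonneg hexp (ENNReal.pow_ne_top (by norm_num))
  refine ⟨2 ^ p * (C₁ * (((3 : ℝ≥0∞) ^ n) ^ (1 - p / p₀)).toNNReal + C₂ ^ p),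
    fun μ _ A₀ hA hA' t f hf Q => ?_⟩
  have hfm : ∀ l, AEStronglyMeasurable (f l) volume := fun l => (hf l).aestronglyMeasurable
  have hdens : densityConst β p μ ≤ A₀ := by
    rcases le_or_gt p 1 with h | h
    · rw [hA h]
    · rw [hA' h]
      exact densityConst_le_kermanSawyerConst h μ
  set N := prodMorreyNorm P p₀ f
  set L := ENNReal.ofReal Q.side
  set V := volume Q.toSet
  have hV0 : V ≠ 0 := Q.volume_toSet_ne_zero
  have hVt : V ≠ ⊤ := Q.volume_toSet_ne_top
  set F : Fin m → E n → ℝ≥0∞ := fun l => Q.triple.toSet.indicator fun z => ‖f l z‖ₑ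
  have hF : ∀ l, AEMeasurable (F l) volume := fun l =>
    (hfm l).enorm.indicator (Cube.measurableSet_toSet _)
  have hFt : ∀ l (R : Cube n), ∫⁻ y in R.toSet, F l y ≠ ⊤ := fun l R => by
    obtain ⟨K, hK, hRK⟩ := R.exists_isCompact_superset
    have h1 : ∫⁻ y in K, ‖f l y‖ₑ < ⊤ := ((hf l).integrableOn_isCompact hK).2
    refine ne_top_of_le_ne_top h1.ne ((lintegral_mono fun y => ?_).trans
      (lintegral_mono_set hRK))
    exact Set.indicator_le_self' (fun _ _ => zero_le) y
  have hFP : ∀ l, ∫⁻ x, F l x ^ P l = ∫⁻ y in Q.triple.toSet, ‖f l y‖ₑ ^ P l := fun l => by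
    rw [← lintegral_indicator (Cube.measurableSet_toSet _)]
    refine lintegral_congr fun x => ?_
    by_cases hx : x ∈ Q.triple.toSet
    · simp [F, hx]
    · simp [F, hx, one_pos.trans (hP l)]
  -- the contribution of the triple of `Q`
  have hloc : ∫⁻ x in Q.toSet, dyadicFracIntegral β t F x ^ p ∂μ ≤
      C₁ * ((3 : ℝ≥0∞) ^ n) ^ (1 - p / p₀) * A₀ ^ p * (V ^ (1 - p / p₀) * N ^ p) := by
    refine (setLIntegral_le_lintegral _ _).trans ((hC₁ μ A₀ hA hA' t F hF hFt).trans ?_)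
    simp only [hFP]
    refine (mul_le_mul_right
      (prod_lintegral_rpow_le (p₀ := p₀) hP hp0 hp f Q.triple) _).trans (le_of_eq ?_)
    rw [Cube.volume_triple, ENNReal.mul_rpow_of_nonneg _ _ hexp]
    ring
  -- the contribution of the scales above that of `Q`
  have hglob : (L ^ (β - n / p₀) * N) ^ p * μ Q.toSet ≤ A₀ ^ p * (V ^ (1 - p / p₀) * N ^ p) := by
    have h1 : L ^ (β - n / p₀) = L ^ β * V ^ (-(1 / p₀)) := by
      simp only [V]
      rw [Q.volume_toSet, ← ENNReal.rpow_natCast, ← ENNReal.rpow_mul,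
        ← ENNReal.rpow_add _ _ Q.ofReal_side_ne_zero ENNReal.ofReal_ne_top]
      congr 1
      ring
    have h2 : (L ^ β) ^ p * μ Q.toSet ≤ A₀ ^ p * V :=
      (Q.side_rpow_mul_measure_le hp0).trans
        (mul_le_mul_left (ENNReal.rpow_le_rpow hdens hp0.le) _)
    have h3 : V * (V ^ (-(1 / p₀))) ^ p = V ^ (1 - p / p₀) := by
      nth_rw 1 [← ENNReal.rpow_one V]
      rw [← ENNReal.rpow_mul, ← ENNReal.rpow_add _ _ hV0 hVt]
      congr 1
      ring
    calc (L ^ (β - n / p₀) * N) ^ p * μ Q.toSet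
        = (L ^ β) ^ p * μ Q.toSet * ((V ^ (-(1 / p₀))) ^ p * N ^ p) := by
          rw [h1, ENNReal.mul_rpow_of_nonneg _ _ hp0.le, ENNReal.mul_rpow_of_nonneg _ _ hp0.le]
          ring
      _ ≤ A₀ ^ p * V * ((V ^ (-(1 / p₀))) ^ p * N ^ p) := mul_le_mul_left h2 _
      _ = _ := by
          rw [← h3]
          ring
  have hadd : ∀ a b : ℝ≥0∞, (a + b) ^ p ≤ 2 ^ p * (a ^ p + b ^ p) := fun a b => by
    simpa using sum_rpow_le_card_rpow_mul Finset.univ ![a, b] hp0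
  calc ∫⁻ x in Q.toSet, dyadicFracIntegral β t (fun l z => ‖f l z‖ₑ) x ^ p ∂μ
      ≤ ∫⁻ x in Q.toSet, 2 ^ p * (dyadicFracIntegral β t F x ^ p +
          (C₂ * (L ^ (β - n / p₀) * N)) ^ p) ∂μ := by
        refine setLIntegral_mono' Q.measurableSet_toSet fun x hx => ?_
        exact (ENNReal.rpow_le_rpow (hC₂ t f hfm Q x hx) hp0.le).trans (hadd _ _)
    _ = 2 ^ p * (∫⁻ x in Q.toSet, dyadicFracIntegral β t F x ^ p ∂μ +
          C₂ ^ p * ((L ^ (β - n / p₀) * N) ^ p * μ Q.toSet)) := by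
        have hmeas := (measurable_dyadicFracIntegral β t F).pow_const p
        rw [lintegral_const_mul _ (hmeas.add_const _), lintegral_add_left hmeas,
          setLIntegral_const, ENNReal.mul_rpow_of_nonneg _ _ hp0.le, mul_assoc]
    _ ≤ 2 ^ p * (C₁ * ((3 : ℝ≥0∞) ^ n) ^ (1 - p / p₀) * A₀ ^ p * (V ^ (1 - p / p₀) * N ^ p) +
          C₂ ^ p * (A₀ ^ p * (V ^ (1 - p / p₀) * N ^ p))) :=
        mul_le_mul_right (add_le_add hloc (mul_le_mul_right hglob _)) _
    _ = _ := by
        rw [ENNReal.coe_mul, ENNReal.coe_add, ENNReal.coe_mul, ENNReal.coe_toNNReal h3t,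
          ENNReal.coe_rpow_of_nonneg _ hp0.le, ENNReal.coe_rpow_of_nonneg _ hp0.le]
        push_cast
        ring

theorem aestronglyMeasurable_fracIntegrand {α : ℝ} {f : Fin m → E n → ℂ}
    (hf : ∀ l, AEStronglyMeasurable (f l) volume) (x : E n) :
    AEStronglyMeasurable (fracIntegrand α f x) volume := by
  have h1 : AEStronglyMeasurable (fun y : Fin m → E n => ∏ l, f l (y l)) volume :=
    Finset.aestronglyMeasurable_fun_prod Finset.univ fun l _ =>
      (hf l).comp_quasiMeasurePreserving (Measure.quasiMeasurePreserving_eval _ l)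
  have h2 : Measurable fun y : Fin m → E n =>
      (((∑ l, ‖x - y l‖) ^ ((m : ℝ) * (n : ℝ) - α) : ℝ) : ℂ) :=
    Complex.measurable_ofReal.comp (Measurable.pow_const (Finset.measurable_fun_sum _ fun l _ =>
      (measurable_const.sub (measurable_pi_apply l)).norm) _)
  exact (h1.aemeasurable.div h2.aemeasurable).aestronglyMeasurable

theorem stronglyMeasurable_fracIntegral {α : ℝ} {f : Fin m → E n → ℂ}
    (hf : ∀ l, AEStronglyMeasurable (f l) volume) :
    StronglyMeasurable (fracIntegral α f) := by
  set g : Fin m → E n → ℂ := fun l => (hf l).mk (f l)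
  have hg : ∀ l, Measurable (g l) := fun l => (hf l).stronglyMeasurable_mk.measurable
  have hfg : fracIntegral α f = fracIntegral α g := by
    ext x
    refine integral_congr_ae ?_
    have h1 : ∀ᵐ y : Fin m → E n, ∀ l, f l (y l) = g l (y l) :=
      Filter.eventually_all.2 fun l =>
        (Measure.quasiMeasurePreserving_eval (fun _ : Fin m => (volume : Measure (E n))) l).ae
          (hf l).ae_eq_mk
    filter_upwards [h1] with y hy
    simp only [fracIntegrand, hy]
  rw [hfg]
  refine StronglyMeasurable.integral_prod_right (f := fun x y => fracIntegrand α g x y)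
    (Measurable.stronglyMeasurable ?_)
  have h1 : Measurable fun z : E n × (Fin m → E n) => ∏ l, g l (z.2 l) :=
    Finset.measurable_fun_prod _ fun l _ =>
      (hg l).comp ((measurable_pi_apply l).comp measurable_snd)
  have h2 : Measurable fun z : E n × (Fin m → E n) =>
      (((∑ l, ‖z.1 - z.2 l‖) ^ ((m : ℝ) * (n : ℝ) - α) : ℝ) : ℂ) :=
    Complex.measurable_ofReal.comp (Measurable.pow_const (Finset.measurable_fun_sum _ fun l _ =>
      (measurable_fst.sub ((measurable_pi_apply l).comp measurable_snd)).norm) _)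
  exact h1.div h2

theorem ae_of_forall_cube {μ : Measure (E n)} {p : E n → Prop}
    (h : ∀ Q : Cube n, ∀ᵐ x ∂μ.restrict Q.toSet, p x) : ∀ᵐ x ∂μ, p x := by
  have hU : (⋃ j : Fin n → ℤ, (gridCube (fun _ => false) (0, j)).toSet) = Set.univ :=
    Set.eq_univ_of_forall fun x => Set.mem_iUnion.2 ⟨_, mem_gridCube_self _ 0 x⟩
  rw [← Measure.restrict_univ (μ := μ), ← hU, ae_restrict_iUnion_iff]
  exact fun j => h _

end Trace

end ProductMorrey

open ProductMorrey

theorem theorem1p2 (n m : ℕ) (P : Fin m → ℝ) (hP : ∀ i, 1 < P i)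
    (p p₀ α β θ q q₀ : ℝ) (hp : 1 / p = ∑ i, 1 / P i)
    (hp_pos : 0 < p) (hpp₀ : p ≤ p₀) (hp₀ : p₀ < (n : ℝ) / α)
    (hβ : 0 < β) (hβα : β ≤ α) (hα : α < (m : ℝ) * (n : ℝ))
    (hθ : θ = ((n : ℝ) - β * p₀) / ((n : ℝ) - α * p₀))
    (hq : q = θ * p) (hq₀ : q₀ = θ * p₀) :
    ∃ C : ℝ≥0, ∀ (μ : Measure (ProductMorrey.E n)) [IsLocallyFiniteMeasure μ] (A₀ : ℝ≥0∞),
      (p ≤ 1 → A₀ = ProductMorrey.densityConst β p μ) →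
      (1 < p → A₀ = ProductMorrey.kermanSawyerConst β p μ) →
      A₀ < ⊤ →
      ∀ f : Fin m → ProductMorrey.E n → ℂ, ProductMorrey.MemProdMorrey P p₀ f →
        (∀ᵐ x ∂μ, Integrable (ProductMorrey.fracIntegrand α f x) volume) ∧
        ProductMorrey.MemRadonMorrey μ q q₀ (ProductMorrey.fracIntegral α f) ∧
        ProductMorrey.radonMorreyNorm μ q q₀ (ProductMorrey.fracIntegral α f) ≤
          (C : ℝ≥0∞) * A₀ ^ (1 / θ) * ProductMorrey.prodMorreyNorm P p₀ f := by
  have hp₀0 : 0 < p₀ := hp_pos.trans_le hpp₀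
  have hα0 : 0 < α := hβ.trans_le hβα
  have hαn : α * p₀ < n := by
    rw [lt_div_iff₀ hα0] at hp₀
    linarith
  have hβn : β * p₀ < n := (mul_le_mul_of_nonneg_right hβα hp₀0.le).trans_lt hαn
  have hn : 0 < n := by
    have : (0 : ℝ) < n := (mul_pos hα0 hp₀0).trans hαn
    exact_mod_cast this
  have hαν : α < n / p₀ := by rwa [lt_div_iff₀ hp₀0]
  have hβν : β < n / p₀ := hβα.trans_lt hαν
  have hd1 : (0 : ℝ) < n - α * p₀ := by linarith
  have hd2 : (0 : ℝ) < n - β * p₀ := by linarith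
  have hθ0 : 0 < θ := by rw [hθ]; positivity
  have hq0 : 0 < q := by rw [hq]; positivity
  have hνα : (0 : ℝ) < n / p₀ - α := by linarith
  have hνβ : (0 : ℝ) < n / p₀ - β := by linarith
  have hexp1 : ((n : ℝ) / p₀ - α) / (n / p₀ - β) * q = p := by
    have h1 : (n : ℝ) - p₀ * α ≠ 0 := by rw [mul_comm]; exact hd1.ne'
    have h2 : (n : ℝ) - p₀ * β ≠ 0 := by rw [mul_comm]; exact hd2.ne'
    rw [hq, hθ]
    field_simp
  have hexp2 : 0 ≤ (α - β) / (n / p₀ - β) * q :=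
    mul_nonneg (div_nonneg (by linarith) hνβ.le) hq0.le
  have hexp3 : (α - β) / (n / p₀ - β) * q + p = q := by
    rw [← hexp1, ← add_mul, ← add_div]
    have : α - β + ((n : ℝ) / p₀ - α) = n / p₀ - β := by ring
    rw [this, div_self hνβ.ne', one_mul]
  obtain ⟨C₁, hC₁⟩ := exists_setLIntegral_dyadicFracIntegral_rpow_le hn hP hp_pos hp hβ hpp₀ hβν
  obtain ⟨C₂, hC₂⟩ := exists_dyadicFracIntegral_le (m := m) hP hβα hαν
  set B : ℝ≥0∞ := (12 : ℝ≥0∞) ^ ((m : ℝ) * n - α)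
  have hB : B ≠ ⊤ := ENNReal.rpow_ne_top_of_ne_zero (by norm_num) (by norm_num)
  set T : ℝ≥0∞ := ((Finset.univ : Finset (Fin n → Bool)).card : ℝ≥0∞)
  have hT : T ≠ ⊤ := ENNReal.natCast_ne_top _
  set K : ℝ≥0∞ := B ^ q * T ^ q * (C₂ : ℝ≥0∞) ^ q * (T * C₁)
  have hK : K ≠ ⊤ := by
    refine ENNReal.mul_ne_top (ENNReal.mul_ne_top (ENNReal.mul_ne_top ?_ ?_) ?_)
      (ENNReal.mul_ne_top hT ENNReal.coe_ne_top) <;>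
    refine ENNReal.rpow_ne_top_of_nonneg hq0.le ?_
    exacts [hB, hT, ENNReal.coe_ne_top]
  have hK' : K ^ (1 / q) ≠ ⊤ := ENNReal.rpow_ne_top_of_nonneg (by positivity) hK
  refine ⟨(K ^ (1 / q)).toNNReal, fun μ _ A₀ hA hA' hAt f hf => ?_⟩
  obtain ⟨hfl, hN⟩ := hf
  have hfm : ∀ l, AEStronglyMeasurable (f l) volume := fun l => (hfl l).aestronglyMeasurable
  set N := prodMorreyNorm P p₀ f
  set D : (Fin n → Bool) → E n → ℝ≥0∞ := fun t =>
    dyadicFracIntegral β t fun l z => ‖f l z‖ₑ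
  have hD : ∀ t, Measurable (D t) := fun t => measurable_dyadicFracIntegral β t _
  set Φ : E n → ℝ≥0∞ := fun x => ∫⁻ y, ‖fracIntegrand α f x y‖ₑ
  have hQ : ∀ t (Q : Cube n), ∫⁻ x in Q.toSet, D t x ^ p ∂μ ≤
      C₁ * A₀ ^ p * (volume Q.toSet ^ (1 - p / p₀) * N ^ p) := fun t Q =>
    hC₁ μ A₀ hA hA' t f hfl Q
  have hΦ : ∀ x, Φ x ≤ B * ∑ t, C₂ * (D t x ^ (((n : ℝ) / p₀ - α) / (n / p₀ - β)) *
      N ^ ((α - β) / (n / p₀ - β))) := fun x =>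
    (lintegral_enorm_fracIntegrand_le hα hfm x).trans
      (mul_le_mul_right (Finset.sum_le_sum fun t _ => hC₂ t f hfm hN.ne x) _)
  have hDfin : ∀ t, ∀ᵐ x ∂μ, D t x < ⊤ := fun t => by
    refine ae_of_forall_cube fun Q => ?_
    have h1 : ∫⁻ x in Q.toSet, D t x ^ p ∂μ ≠ ⊤ := by
      refine ne_top_of_le_ne_top (ENNReal.mul_ne_top (ENNReal.mul_ne_top ENNReal.coe_ne_top
        (ENNReal.rpow_ne_top_of_nonneg hp_pos.le hAt.ne)) (ENNReal.mul_ne_top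
        (ENNReal.rpow_ne_top_of_ne_zero Q.volume_toSet_ne_zero Q.volume_toSet_ne_top)
        (ENNReal.rpow_ne_top_of_nonneg hp_pos.le hN.ne))) (hQ t Q)
    filter_upwards [ae_lt_top ((hD t).pow_const p) h1] with x hx
    exact (ENNReal.rpow_lt_top_iff_of_pos hp_pos).1 hx
  have hint : ∀ᵐ x ∂μ, Integrable (fracIntegrand α f x) volume := by
    filter_upwards [Filter.eventually_all.2 hDfin] with x hx
    refine ⟨aestronglyMeasurable_fracIntegrand hfm x, (hΦ x).trans_lt ?_⟩
    refine ENNReal.mul_lt_top hB.lt_top (ENNReal.sum_lt_top.2 fun t _ =>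
      ENNReal.mul_lt_top ENNReal.coe_lt_top (ENNReal.mul_lt_top ?_ ?_))
    · exact ENNReal.rpow_lt_top_of_nonneg (by positivity) (hx t).ne
    · exact ENNReal.rpow_lt_top_of_nonneg (div_nonneg (by linarith) hνβ.le) hN.ne
  have hΦq : ∀ x, ‖fracIntegral α f x‖ₑ ^ q ≤ B ^ q * T ^ q * (C₂ : ℝ≥0∞) ^ q *
      N ^ ((α - β) / (n / p₀ - β) * q) * ∑ t, D t x ^ p := fun x => by
    have h1 : ‖fracIntegral α f x‖ₑ ≤ Φ x := enorm_integral_le_lintegral_enorm _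
    refine (ENNReal.rpow_le_rpow (h1.trans (hΦ x)) hq0.le).trans ?_
    rw [ENNReal.mul_rpow_of_nonneg _ _ hq0.le]
    refine (mul_le_mul_right (sum_rpow_le_card_rpow_mul _ _ hq0) _).trans (le_of_eq ?_)
    simp only [ENNReal.mul_rpow_of_nonneg _ _ hq0.le, ← ENNReal.rpow_mul, hexp1]
    rw [← Finset.mul_sum, ← Finset.sum_mul]
    ring
  have hcube : ∀ Q : Cube n, ∫⁻ x in Q.toSet, ‖fracIntegral α f x‖ₑ ^ q ∂μ ≤
      K * (A₀ ^ p * (volume Q.toSet ^ (1 - p / p₀) * N ^ q)) := fun Q => by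
    refine (lintegral_mono hΦq).trans ?_
    rw [lintegral_const_mul _ (Finset.measurable_fun_sum _ fun t _ => (hD t).pow_const p),
      lintegral_finsetSum _ fun t _ => (hD t).pow_const p]
    refine (mul_le_mul_right (Finset.sum_le_sum fun t _ => hQ t Q) _).trans (le_of_eq ?_)
    rw [Finset.sum_const, nsmul_eq_mul]
    have hNq : N ^ q = N ^ ((α - β) / (n / p₀ - β) * q) * N ^ p := by
      rw [← ENNReal.rpow_add_of_nonneg _ _ hexp2 hp_pos.le, hexp3]
    rw [hNq]
    simp only [K, T]
    ring
  have hnorm : radonMorreyNorm μ q q₀ (fracIntegral α f) ≤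
      ((K ^ (1 / q)).toNNReal : ℝ≥0∞) * A₀ ^ (1 / θ) * N := by
    rw [ENNReal.coe_toNNReal hK']
    refine iSup_le fun Q => ?_
    have hV0 := Q.volume_toSet_ne_zero
    have hVt := Q.volume_toSet_ne_top
    have hqi : 0 ≤ 1 / q := by positivity
    refine (mul_le_mul_right (ENNReal.rpow_le_rpow (hcube Q) hqi) _).trans (le_of_eq ?_)
    simp only [ENNReal.mul_rpow_of_nonneg _ _ hqi, ← ENNReal.rpow_mul]
    have e1 : p * (1 / q) = 1 / θ := by
      rw [hq]
      field_simp
    have e2 : q * (1 / q) = 1 := mul_one_div_cancel hq0.ne'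
    have e3 : (1 / q₀ - 1 / q) + (1 - p / p₀) * (1 / q) = 0 := by
      rw [hq, hq₀]
      field_simp
      ring
    have e4 : volume Q.toSet ^ (1 / q₀ - 1 / q) *
        volume Q.toSet ^ ((1 - p / p₀) * (1 / q)) = 1 := by
      rw [← ENNReal.rpow_add _ _ hV0 hVt, e3, ENNReal.rpow_zero]
    rw [e1, e2, ENNReal.rpow_one]
    calc _ = volume Q.toSet ^ (1 / q₀ - 1 / q) *
          volume Q.toSet ^ ((1 - p / p₀) * (1 / q)) * (K ^ (1 / q) * A₀ ^ (1 / θ) * N) := by ring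
      _ = _ := by rw [e4, one_mul]
  refine ⟨hint, ⟨(stronglyMeasurable_fracIntegral hfm).aestronglyMeasurable,
    hnorm.trans_lt ?_⟩, hnorm⟩
  exact ENNReal.mul_lt_top (ENNReal.mul_lt_top ENNReal.coe_lt_top
    (ENNReal.rpow_lt_top_of_nonneg (by positivity) hAt.ne)) hN
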